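/- Let $\mathcal C$ be a cocomplete category, let $(T_1,\eta_1)$ and $(T_2,\eta_2)$ be pointed endofunctors on $\mathcal C$ (functors with natural transformations $\eta_i : 1 \Rightarrow T_i$), and let $\gamma : T_2 \Rightarrow T_1$ and $\lambda : T_2 \Rightarrow T_1T_1$ be natural transformations. **Definitions.** A *special $T_1$-algebra* is an object $A$ with a map $\beta : T_1A \to A$ such that $\beta\circ(\eta_1)_A = 1_A$ and $\beta\circ\gamma_A = \beta\circ T_1\beta\circ\lambda_A$; morphisms are the maps $f$ with $f\circ\beta=\beta'\circ T_1f$. A *special algebraic chain* is a functor $X : \mathrm{Ord}\to\mathcal C$ on the ordered class of (small) ordinals, with connecting maps $j_n^m : X_n\to X_m$, together with maps $x_n : T_1X_n\to X_{n+1}$ for all ordinals $n$, such that $x_n\circ(\eta_1)_{X_n} = j_n^{n+1}$ for all $n$, $x_m\circ T_1j_n^m = j_{n+1}^{m+1}\circ x_n$ for all $n<m$, and $j_{n+1}^{n+2}\circ x_n\circ\gamma_{X_n} = x_{n+1}\circ T_1x_n\circ\lambda_{X_n}$ for all $n$; morphisms are the natural transformations $f$ with $f_{n+1}\circ x_n =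 y_n\circ T_1f_n$ for all $n$. It *stabilises at* $n$ if $j_n^m$ is invertible for all $m>n$, and it *stabilises* if it does so at some ordinal. For $X\in\mathcal C$, let $X^\star$ denote the special algebraic chain given, up to the choice of colimits, as follows: * $X^\star_0=X$, $X^\star_1=T_1X$ and $x_0=1$. * For every ordinal $n$, $x_{n+1} : T_1X^\star_{n+1}\to X^\star_{n+2}$ is the joint coequaliser of the two parallel pairs $$T_1x_n\circ T_1(\eta_1)_{X^\star_n},\ \ T_1x_n\circ(\eta_1)_{T_1X^\star_n} : T_1X^\star_n\rightrightarrows T_1X^\star_{n+1}$$ and $$T_1x_n\circ\lambda_{X^\star_n},\ \ T_1(j_n^{n+1})\circ\gamma_{X^\star_n} : T_2X^\star_n\rightrightarrows T_1X^\star_{n+1}.$$ * For every limit ordinal $m$, $X^\star_m=\operatorname{colim}_{n<m}X^\star_n$ with the $j_n^m$ as colimit inclusions, and $x_m : T_1X^\star_m\to X^\star_{m+1}$ is the coequaliser of the two maps $\operatorname{colim}_{n<m}T_1X^\star_n\rightrightarrows T_1X^\star_m$ with components $T_1j_n^m$ and $(\eta_1)_{X^\star_m}\circ j_{n+1}^m\circ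 x_n$. * Throughout, $j_n^{n+1}=x_n\circ(\eta_1)_{X^\star_n}$. **Theorem.** Suppose that there is a limit ordinal $\alpha$ (limit ordinals being nonzero) such that either (a) $T_1$ and $T_2$ both preserve colimits of $\alpha$-chains, i.e. of functors $\mathrm{Ord}_{<\alpha}\to\mathcal C$; or (b) there is a factorisation system $(E,M)$ on $\mathcal C$ which is proper ($E$-maps are epi and $M$-maps are mono) and co-well-powered (each object $A$ has, up to isomorphism under $A$, only a set of $E$-maps with domain $A$), such that $T_1$ and $T_2$ both preserve colimits of $(\alpha,M)$-chains, i.e. of $\alpha$-chains all of whose connecting maps are in $M$. Then, for each $X\in\mathcal C$, the chain $X^\star$ exists and is the free special algebraic chain on $X$, with respect to the forgetful functor sending a special algebraic chain to its value at $0$ and with unit the identity $X = X^\star_0$. Moreover: 1. $X^\star$ stabilises; 2. for every ordinal $n$ at which $X^\star$ stabilises, $X^\star_n$ with the structure map $(j_n^{n+1})^{-1}\circ x_n : T_1X^\star_n\to X^\star_n$ is a special $T_1$-algebra, and it is the free special $T_1$-algebra on $X$ with unit $j_0^n : X\to X^\star_n$. -/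

import Mathlib

open CategoryTheory CategoryTheory.Limits

universe w v u

namespace SpecialChains

section Generalities

variable {C : Type u} [Category.{v} C]

/-- An (orthogonal) factorisation system `(E, M)`: both classes are closed under composition with
isomorphisms, every morphism is an `E`-map followed by an `M`-map, and `E`-maps have unique
diagonal fillers against `M`-maps. -/
structure IsFactorisationSystem (E M : MorphismProperty C) : Prop where
  respectsIso_left : E.RespectsIso
  respectsIso_right : M.RespectsIso
  factorisation : ∀ {A B : C} (f : A ⟶ B),
    ∃ (I : C) (e : A ⟶ I) (m : I ⟶ B), E e ∧ M m ∧ e ≫ m = f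
  diagonal : ∀ {A B X Y : C} (e : A ⟶ B) (m : X ⟶ Y) (a : A ⟶ X) (b : B ⟶ Y),
    E e → M m → a ≫ m = e ≫ b → ∃! d : B ⟶ X, e ≫ d = a ∧ d ≫ m = b

/-- `(E, M)` is proper: `E`-maps are epimorphisms and `M`-maps are monomorphisms. -/
structure IsProper (E M : MorphismProperty C) : Prop where
  epi : ∀ {A B : C} (f : A ⟶ B), E f → Epi f
  mono : ∀ {A B : C} (f : A ⟶ B), M f → Mono f

/-- Every object has, up to isomorphism under it, only a (`w`-small) set of `E`-quotients. -/
def IsCoWellPowered (E : MorphismProperty C) : Prop :=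
  ∀ A : C, ∃ (ι : Type w) (Q : ι → C) (q : ∀ i, A ⟶ Q i),
    ∀ (B : C) (f : A ⟶ B), E f → ∃ (i : ι) (e : Q i ≅ B), q i ≫ e.hom = f

/-- `T` preserves colimits of `α`-chains, i.e. of functors out of the ordinals below `α`. -/
def PreservesChains (α : Ordinal.{w}) (T : C ⥤ C) : Prop :=
  ∀ F : Set.Iio α ⥤ C, PreservesColimit F T

/-- `T` preserves colimits of `(α, M)`-chains: those `α`-chains with connecting maps in `M`. -/
def PreservesMChains (α : Ordinal.{w}) (M : MorphismProperty C) (T : C ⥤ C) : Prop :=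
  ∀ F : Set.Iio α ⥤ C, (∀ {i j : Set.Iio α} (f : i ⟶ j), M (F.map f)) → PreservesColimit F T

/-- `p` is a joint coequaliser of the parallel pairs `f i, g i : A i ⟶ B`. -/
def IsJointCoequaliser {ι : Type*} {A : ι → C} {B Q : C} (f g : ∀ i, A i ⟶ B) (p : B ⟶ Q) :
    Prop :=
  (∀ i, f i ≫ p = g i ≫ p) ∧
    ∀ {Z : C} (h : B ⟶ Z), (∀ i, f i ≫ h = g i ≫ h) → ∃! k : Q ⟶ Z, p ≫ k = h

/-- `p` is a joint coequaliser of the two parallel pairs `f, g : A ⟶ B` and `f', g' : A' ⟶ B`. -/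
def IsJointCoequaliserTwo {A A' B Q : C} (f g : A ⟶ B) (f' g' : A' ⟶ B) (p : B ⟶ Q) : Prop :=
  (f ≫ p = g ≫ p ∧ f' ≫ p = g' ≫ p) ∧
    ∀ {Z : C} (h : B ⟶ Z), f ≫ h = g ≫ h → f' ≫ h = g' ≫ h → ∃! k : Q ⟶ Z, p ≫ k = h

/-- `A`, with unit `unit : X ⟶ U A`, is the free object on `X` with respect to `U : D ⥤ C`: every
`f : X ⟶ U B` factors as `U g ∘ unit` for a unique `g : A ⟶ B`. -/
def IsFreeOn {D : Type*} [Category* D] (U : D ⥤ C) (X : C) (A : D) (unit : X ⟶ U.obj A) : Prop :=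
  ∀ (B : D) (f : X ⟶ U.obj B), ∃! g : A ⟶ B, unit ≫ U.map g = f

end Generalities

variable {C : Type u} [Category.{v} C] {T T₂ : C ⥤ C}

/-- An algebraic chain for the pointed endofunctor `(T, η)`: a functor `X` on the ordered class of
ordinals with maps `x n : T X_n ⟶ X_{n+1}` compatible with `η` and with the connecting maps. -/
structure AlgebraicChain (η : 𝟭 C ⟶ T) where
  X : Ordinal.{w} ⥤ C
  x : ∀ n : Ordinal.{w}, T.obj (X.obj n) ⟶ X.obj (n + 1)
  unit : ∀ n : Ordinal.{w}, η.app (X.obj n) ≫ x n = X.map (homOfLE le_self_add)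
  compat : ∀ {n m : Ordinal.{w}} (h : n < m),
    T.map (X.map (homOfLE h.le)) ≫ x m =
      x n ≫ X.map (homOfLE (add_le_add_left h.le 1 : n + 1 ≤ m + 1))

namespace AlgebraicChain

variable {η : 𝟭 C ⟶ T}

/-- The connecting map `j_n^m : X_n ⟶ X_m` of an algebraic chain. -/
def j (S : AlgebraicChain.{w} η) {n m : Ordinal.{w}} (h : n ≤ m) : S.X.obj n ⟶ S.X.obj m :=
  S.X.map (homOfLE h)

/-- A morphism of algebraic chains: a natural transformation commuting with the structure maps. -/
@[ext]
structure Hom (S R : AlgebraicChain.{w} η) where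
  f : S.X ⟶ R.X
  comm : ∀ n : Ordinal.{w}, T.map (f.app n) ≫ R.x n = S.x n ≫ f.app (n + 1)

instance : Category (AlgebraicChain.{w} η) where
  Hom := Hom
  id S := { f := 𝟙 S.X, comm := fun n => by simp }
  comp a b := { f := a.f ≫ b.f, comm := fun n => by simp [b.comm, reassoc_of% a.comm] }

/-- The forgetful functor sending an algebraic chain to its value at `0`. -/
def forget (η : 𝟭 C ⟶ T) : AlgebraicChain.{w} η ⥤ C where
  obj S := S.X.obj 0
  map a := a.f.app 0

/-- The chain stabilises at `n`: all connecting maps out of `X_n` are invertible. -/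
def StabilisesAt (S : AlgebraicChain.{w} η) (n : Ordinal.{w}) : Prop :=
  ∀ (m : Ordinal.{w}) (h : n < m), IsIso (S.j h.le)

/-- The chain stabilises at some ordinal. -/
def Stabilises (S : AlgebraicChain.{w} η) : Prop :=
  ∃ n : Ordinal.{w}, S.StabilisesAt n

/-- At an ordinal `n` where the chain stabilises, the structure map
`(j_n^{n+1})⁻¹ ∘ x_n : T X_n ⟶ X_n`. -/
noncomputable def pointAlgebra (S : AlgebraicChain.{w} η) (n : Ordinal.{w})
    (hn : S.StabilisesAt n) : Endofunctor.Algebra T :=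
  haveI : IsIso (S.j (le_self_add : n ≤ n + 1)) := hn (n + 1) (lt_add_one n)
  { a := S.X.obj n
    str := S.x n ≫ inv (S.j (le_self_add : n ≤ n + 1)) }

end AlgebraicChain

/-- The algebras for the pointed endofunctor `(T, η)` that are special with respect to `γ` and
`lam`, as a property of algebras for the endofunctor `T`. -/
def IsSpecialAlgebra (η : 𝟭 C ⟶ T) (γ : T₂ ⟶ T) (lam : T₂ ⟶ T ⋙ T) :
    ObjectProperty (Endofunctor.Algebra T) :=
  fun A => η.app A.a ≫ A.str = 𝟙 A.a ∧
    γ.app A.a ≫ A.str = lam.app A.a ≫ T.map A.str ≫ A.str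

/-- The category of special algebras, as a full subcategory. -/
abbrev SpecialAlgebra (η : 𝟭 C ⟶ T) (γ : T₂ ⟶ T) (lam : T₂ ⟶ T ⋙ T) :=
  (IsSpecialAlgebra η γ lam).FullSubcategory

/-- The forgetful functor from special algebras to the base category. -/
abbrev SpecialAlgebra.forget (η : 𝟭 C ⟶ T) (γ : T₂ ⟶ T) (lam : T₂ ⟶ T ⋙ T) :
    SpecialAlgebra η γ lam ⥤ C :=
  (IsSpecialAlgebra η γ lam).ι ⋙ Endofunctor.Algebra.forget T

/-- The condition that makes an algebraic chain special with respect to `γ` and `lam`. -/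
def IsSpecialChain (η : 𝟭 C ⟶ T) (γ : T₂ ⟶ T) (lam : T₂ ⟶ T ⋙ T) :
    ObjectProperty (AlgebraicChain.{w} η) :=
  fun S => ∀ n : Ordinal.{w},
    γ.app (S.X.obj n) ≫ S.x n ≫ S.j (le_self_add : n + 1 ≤ n + 1 + 1) =
      lam.app (S.X.obj n) ≫ T.map (S.x n) ≫ S.x (n + 1)

/-- The category of special algebraic chains, as a full subcategory. -/
abbrev SpecialChain (η : 𝟭 C ⟶ T) (γ : T₂ ⟶ T) (lam : T₂ ⟶ T ⋙ T) :=
  (IsSpecialChain.{w} η γ lam).FullSubcategory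

/-- The forgetful functor from special algebraic chains to the base category: the value at `0`. -/
abbrev SpecialChain.forget (η : 𝟭 C ⟶ T) (γ : T₂ ⟶ T) (lam : T₂ ⟶ T ⋙ T) :
    SpecialChain.{w} η γ lam ⥤ C :=
  (IsSpecialChain.{w} η γ lam).ι ⋙ AlgebraicChain.forget η

/-- The special algebraic chain `S`, with `i : X ≅ S_0`, is the chain `X⋆` given by the explicit
transfinite formulas (each colimit being determined up to isomorphism). The connecting maps
`j_n^{n+1}` are `x_n ∘ η`, which is part of being an algebraic chain. -/
structure IsStarChain {η : 𝟭 C ⟶ T} {γ : T₂ ⟶ T} {lam : T₂ ⟶ T ⋙ T} (X : C)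
    (S : SpecialChain.{w} η γ lam) (i : X ≅ S.obj.X.obj 0) : Prop where
  /-- `X_1 = T X` with `x_0` the identity, up to isomorphism. -/
  first : IsIso (S.obj.x 0)
  /-- `x_{n+1} : T X_{n+1} ⟶ X_{n+2}` is the joint coequaliser of two parallel pairs, one from
  `T X_n` and one from `T₂ X_n`. -/
  step : ∀ n : Ordinal.{w}, IsJointCoequaliserTwo
    (T.map (η.app (S.obj.X.obj n)) ≫ T.map (S.obj.x n))
    (η.app (T.obj (S.obj.X.obj n)) ≫ T.map (S.obj.x n))
    (lam.app (S.obj.X.obj n) ≫ T.map (S.obj.x n))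
    (γ.app (S.obj.X.obj n) ≫ T.map (S.obj.j (le_self_add : n ≤ n + 1)))
    (S.obj.x (n + 1))
  /-- `X_α` is the colimit of the `X_n` with `n < α`, for `α` a limit ordinal. -/
  limit : S.obj.X.IsWellOrderContinuous
  /-- For `α` a limit ordinal, `x_α : T X_α ⟶ X_{α+1}` is the coequaliser of the two maps out of
  the colimit of the `T X_n`, `n < α`, given on the summands as below; a coequaliser of two maps
  out of a colimit is the joint coequaliser of their components. -/
  limit_step : ∀ (α : Ordinal.{w}) (_ : Order.IsSuccLimit α),
    IsJointCoequaliser (A := fun n : Set.Iio α => T.obj (S.obj.X.obj n))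
      (fun n => T.map (S.obj.j (le_of_lt n.2)))
      (fun n => S.obj.x n ≫ S.obj.j (Order.add_one_le_of_lt n.2) ≫ η.app (S.obj.X.obj α))
      (S.obj.x α)

end SpecialChains

/-! The recursion for X⋆ looks back one place, since x_{n+1} is built from x_n. Packing two
successive objects and the maps between them into a `Stage` turns it into the iteration of one
operation on one category (`exists_iteration`). A colimit of stages need not satisfy j = x ∘ η, so
the passage to the next stage begins with a coequaliser π forcing it. At zero and at successors π is
invertible; at a limit it completes the pushout in the colimit of stages to the coequaliser
prescribed for X⋆ (`chainOfStages_limit_step`).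

Freeness holds because each x_n is epi and limit stages are colimits, so a morphism out of X⋆ is
determined at 0, while the colimits defining X⋆ impose only equations valid in every special chain
(`exists_isComponent`). Special algebras are constant special chains, so X⋆ also maps to them; where
it stabilises, this makes its value the free algebra.

If both functors preserve the colimit X_α, the maps x_n with n < α glue to a special algebra
structure on X_α. Mapping X⋆ to the constant chain on this algebra yields inverses to the connecting
maps out of X_α (`stabilisesAt_of_algebra`).

Under the factorisation hypothesis, co-well-poweredness makes the images of X_n in later stages
settle down (`exists_stable_image`). Along a suitable α-sequence of ordinals these images form an
(α, M)-chain interleaved with X⋆, so the functors preserve the colimit of X⋆ at the supremum of the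
sequence (`exists_preservesColimit`), and the same stabilisation argument applies there. -/

namespace SpecialChains

/-! ### Transfinite iteration along a possibly large well-order -/

section Iteration

open SmallObject SmallObject.SuccStruct

variable {D : Type u} [Category.{v} D] (Φ : SuccStruct D)
  {J : Type w} [LinearOrder J] [OrderBot J] [SuccOrder J]
  [∀ j : J, HasColimitsOfShape (Set.Iio j) D]

/-- The arrow `colimit.ι F k`. -/
noncomputable def ιArrow {i : J} (F : Set.Iio i ⥤ D) (k : J) (hk : k < i) : Arrow D :=
  Arrow.mk (colimit.ι F ⟨k, hk⟩)

/-- The iterations of a successor structure up to `j`, as in `SuccStruct.Iteration`, but without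
asking for colimits indexed by all of `J`, so that `J` may be the ordered class of ordinals. -/
@[ext]
structure IterationUpTo (j : J) where
  F : Set.Iic j ⥤ D
  obj_bot : F.obj ⟨⊥, bot_le⟩ = Φ.X₀
  arrowSucc_eq (i : J) (hi : i < j) : arrowSucc F i hi = Φ.toSuccArrow (F.obj ⟨i, hi.le⟩)
  arrowMap_limit (i : J) (hi : Order.IsSuccLimit i) (hij : i ≤ j) (k : J) (hk : k < i) :
    arrowMap F k i hk.le hij = ιArrow (restrictionLT F hij) k hk

namespace IterationUpTo

variable {Φ} {j : J}

section

variable (I : IterationUpTo Φ j)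

lemma obj_succ (i : J) (hi : i < j) :
    I.F.obj ⟨Order.succ i, Order.succ_le_of_lt hi⟩ = Φ.succ (I.F.obj ⟨i, hi.le⟩) :=
  congr_arg Comma.right (I.arrowSucc_eq i hi)

lemma obj_limit (i : J) (hi : Order.IsSuccLimit i) (hij : i ≤ j) :
    I.F.obj ⟨i, hij⟩ = colimit (restrictionLT I.F hij) :=
  congr_arg Comma.right (I.arrowMap_limit i hi hij ⊥ (Order.IsSuccLimit.bot_lt hi))

/-- Restriction of an iteration to a shorter interval. -/
def trunc {j' : J} (hj' : j' ≤ j) : IterationUpTo Φ j' where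
  F := restrictionLE I.F hj'
  obj_bot := I.obj_bot
  arrowSucc_eq i hi := I.arrowSucc_eq i (lt_of_lt_of_le hi hj')
  arrowMap_limit i hi hij k hk := I.arrowMap_limit i hi (hij.trans hj') k hk

lemma trunc_F {j' : J} (hj' : j' ≤ j) : (I.trunc hj').F = restrictionLE I.F hj' := rfl

end

variable [WellFoundedLT J]

-- The base object, the successor arrows and the colimit inclusions are prescribed by equalities, so
-- induction gives literal equality. This is what lets independently chosen iterations of different
-- lengths be glued.
open Iteration.subsingleton in
instance subsingleton : Subsingleton (IterationUpTo Φ j) where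
  allEq I₁ I₂ := by
    suffices I₁.F = I₂.F from IterationUpTo.ext this
    revert I₁ I₂
    induction j using SuccOrder.limitRecOn with
    | isMin j h =>
      obtain rfl := h.eq_bot
      intro I₁ I₂
      refine Iteration.subsingleton.ext (fun k₁ k₂ h₁₂ h₂ ↦ ?_)
      obtain rfl : k₂ = ⊥ := by simpa using h₂
      obtain rfl : k₁ = ⊥ := by simpa using h₁₂
      exact mapEq_refl _ _ (I₁.obj_bot.trans I₂.obj_bot.symm)
    | succ j hj₁ hj₂ =>
      intro I₁ I₂
      refine Iteration.subsingleton.ext (fun k₁ k₂ h₁₂ h₂ ↦ ?_)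
      have h₀ := Order.le_succ j
      replace hj₂ := hj₂ (I₁.trunc h₀) (I₂.trunc h₀)
      rw [trunc_F, trunc_F] at hj₂
      have hsucc : I₁.F.obj ⟨j, h₀⟩ = I₂.F.obj ⟨j, h₀⟩ := Functor.congr_obj hj₂ ⟨j, le_rfl⟩
      -- Arrows ending at or before `j` are covered by the inductive hypothesis; only those ending
      -- at the new top remain.
      wlog h : k₂ ≤ j generalizing k₁ k₂
      · obtain h₂ | rfl := h₂.lt_or_eq
        · exact this _ _ _ _ ((Order.lt_succ_iff_of_not_isMax hj₁).1 h₂)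
        · by_cases h' : k₁ ≤ j
          · apply mapEq_trans _ h₀ (this k₁ j h' h₀ le_rfl)
            simp only [MapEq, ← arrowSucc_def _ _ (Order.lt_succ_of_not_isMax hj₁),
              arrowSucc_eq, hsucc]
          · simp only [not_le] at h'
            obtain rfl : k₁ = Order.succ j := le_antisymm h₁₂
              ((Order.succ_le_iff_of_not_isMax hj₁).2 h')
            rw [MapEq, arrowMap_refl, arrowMap_refl,
              obj_succ _ _ h', obj_succ _ _ h', hsucc]
      simp only [MapEq, ← arrowMap_restrictionLE _ (Order.le_succ j) _ _ _ h, hj₂]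
    | isSuccLimit j h₁ h₂ =>
      intro I₁ I₂
      refine Iteration.subsingleton.ext (fun k₁ k₂ h₁₂ h₃ ↦ ?_)
      wlog h₄ : k₂ < j generalizing k₁ k₂; swap
      · have := h₂ k₂ h₄ (I₁.trunc h₄.le) (I₂.trunc h₄.le)
        rw [trunc_F, trunc_F] at this
        simp only [MapEq, ← arrowMap_restrictionLE _ h₄.le _ _ _ (le_refl k₂), this]
      · obtain rfl : j = k₂ := le_antisymm (by simpa using h₄) h₃
        have : restrictionLT I₁.F le_rfl = restrictionLT I₂.F le_rfl :=
          Arrow.functor_ext (fun _ l _ ↦ this _ _ _ _ l.2)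
        by_cases h₅ : k₁ < j
        · rw [MapEq, arrowMap_limit _ _ h₁ _ _ h₅, arrowMap_limit _ _ h₁ _ _ h₅, this]
        · obtain rfl : k₁ = j := le_antisymm h₁₂ (by simpa using h₅)
          apply mapEq_refl
          simp only [obj_limit _ _ h₁, this]

lemma congr_arrowMap {j₁ j₂ : J} (I₁ : IterationUpTo Φ j₁) (I₂ : IterationUpTo Φ j₂)
    {k₁ k₂ : J} (h : k₁ ≤ k₂) (h₁ : k₂ ≤ j₁) (h₂ : k₂ ≤ j₂) :
    arrowMap I₁.F k₁ k₂ h h₁ = arrowMap I₂.F k₁ k₂ h h₂ := by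
  wlog hj : j₁ ≤ j₂ generalizing j₁ j₂
  · exact (this I₂ I₁ h₂ h₁ (not_le.1 hj).le).symm
  rw [Subsingleton.elim I₁ (I₂.trunc hj)]
  rfl

lemma congr_obj {j₁ j₂ : J} (I₁ : IterationUpTo Φ j₁) (I₂ : IterationUpTo Φ j₂)
    (k : J) (h₁ : k ≤ j₁) (h₂ : k ≤ j₂) :
    I₁.F.obj ⟨k, h₁⟩ = I₂.F.obj ⟨k, h₂⟩ :=
  congr_arg Comma.left (congr_arrowMap I₁ I₂ le_rfl h₁ h₂)

lemma congr_map {j₁ j₂ : J} (I₁ : IterationUpTo Φ j₁) (I₂ : IterationUpTo Φ j₂)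
    {k₁ k₂ : J} (h : k₁ ≤ k₂) (h₁ : k₂ ≤ j₁) (h₂ : k₂ ≤ j₂) :
    I₁.F.map (homOfLE h : (⟨k₁, h.trans h₁⟩ : Set.Iic j₁) ⟶ ⟨k₂, h₁⟩) =
      eqToHom (congr_obj I₁ I₂ k₁ (h.trans h₁) (h.trans h₂)) ≫
        I₂.F.map (homOfLE h : (⟨k₁, h.trans h₂⟩ : Set.Iic j₂) ⟶ ⟨k₂, h₂⟩) ≫
        eqToHom (congr_obj I₁ I₂ k₂ h₁ h₂).symm :=
  ((Arrow.mk_eq_mk_iff _ _).1 (congr_arrowMap I₁ I₂ h h₁ h₂)).2.2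

/-- The functor which glues together iterations of all lengths in a lower set. -/
def glue {s : Set J} (I : ∀ i : s, IterationUpTo Φ i.1) : s ⥤ D where
  obj i := (I i).F.obj ⟨i.1, le_refl i.1⟩
  map {i₁ i₂} f := eqToHom (congr_obj (I i₁) (I i₂) i₁.1 (le_refl i₁.1) (leOfHom f)) ≫
    (I i₂).F.map (homOfLE (leOfHom f) : (⟨i₁.1, leOfHom f⟩ : Set.Iic i₂.1) ⟶ ⟨i₂.1, le_refl i₂.1⟩)
  map_id i := by
    rw [eqToHom_refl, Category.id_comp]
    exact (I i).F.map_id _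
  map_comp {i₁ i₂ i₃} f g := by
    have h := congr_map (I i₂) (I i₃) (leOfHom f) (le_refl i₂.1) (leOfHom g)
    simp only [h, Category.assoc, eqToHom_trans_assoc, eqToHom_refl, Category.id_comp,
      ← Functor.map_comp]
    rfl

lemma arrow_glue {s : Set J} (I : ∀ i : s, IterationUpTo Φ i.1) (i₁ i₂ : s) (h : i₁ ≤ i₂)
    {k : J} (I' : IterationUpTo Φ k) (hk : i₂.1 ≤ k) :
    Arrow.mk ((glue I).map (homOfLE h)) = arrowMap I'.F i₁.1 i₂.1 h hk := by
  rw [congr_arrowMap I' (I i₂) h hk le_rfl]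
  simp [glue, arrowMap]

variable (Φ J) in
/-- The iteration of length zero. -/
def mkOfBot : IterationUpTo Φ (⊥ : J) where
  F := (Functor.const _).obj Φ.X₀
  obj_bot := rfl
  arrowSucc_eq _ h := by simp at h
  arrowMap_limit _ h₁ h₂ := (h₁.not_isMin (by simpa using h₂)).elim

/-- The extension of an iteration by one step. -/
noncomputable def mkOfSucc (hj : ¬IsMax j) (I : IterationUpTo Φ j) :
    IterationUpTo Φ (Order.succ j) where
  F := extendToSucc hj I.F (Φ.toSucc _)
  obj_bot := by rw [extendToSucc_obj_eq _ _ _ _ bot_le, obj_bot]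
  arrowSucc_eq i hi₁ := by
    rw [Order.lt_succ_iff_of_not_isMax hj] at hi₁
    obtain hi₁ | rfl := lt_or_eq_of_le hi₁
    · rw [arrowSucc_def, arrowMap_extendToSucc _ _ _ _ _ _ (Order.succ_le_of_lt hi₁),
        ← arrowSucc_def _ _ hi₁, I.arrowSucc_eq i hi₁,
        extendToSucc_obj_eq hj I.F (Φ.toSucc _) i hi₁.le]
    · rw [arrowSucc_extendToSucc, toSuccArrow,
        extendToSucc_obj_eq hj I.F (Φ.toSucc _) i le_rfl]
  arrowMap_limit i hi hij k hk := by
    have hij' := (Order.IsSuccLimit.le_succ_iff hi).1 hij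
    rw [arrowMap_extendToSucc _ _ _ _ _ _ hij', arrowMap_limit _ _ hi _ _ hk]
    have : restrictionLT I.F hij' = restrictionLT (extendToSucc hj I.F (Φ.toSucc _)) hij :=
      Arrow.functor_ext fun k₁ k₂ f ↦ (arrowMap_extendToSucc hj I.F (Φ.toSucc _) k₁.1 k₂.1
        (leOfHom f) (k₂.2.le.trans hij')).symm
    rw [this]

/-- The iteration of limit length which extends given shorter ones. -/
noncomputable def mkOfLimit (hj : Order.IsSuccLimit j)
    (I : ∀ i : Set.Iio j, IterationUpTo Φ i.1) : IterationUpTo Φ j where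
  F := ofCocone (colimit.cocone (glue I))
  obj_bot := by
    rw [ofCocone_obj_eq _ _ hj.bot_lt]
    exact congr_obj (I ⟨⊥, hj.bot_lt⟩) (mkOfBot Φ J) ⊥ bot_le le_rfl
  arrowSucc_eq i hi := by
    have hs := hj.succ_lt_iff.2 hi
    have hi' := Order.lt_succ_of_not_isMax (not_isMax_of_lt hi)
    rw [arrowSucc_def, arrowMap_ofCocone _ _ _ _ hs]
    rw [ofCocone_obj_eq _ _ hi]
    refine (arrow_glue I ⟨i, hi⟩ ⟨Order.succ i, hs⟩ (Order.le_succ i) (I ⟨_, hs⟩) le_rfl).trans ?_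
    rw [← arrowSucc_def _ _ hi', arrowSucc_eq]
    exact congr_arg Φ.toSuccArrow (congr_obj (I ⟨_, hs⟩) (I ⟨i, hi⟩) i (Order.le_succ i) le_rfl)
  arrowMap_limit i hi hij k hk := by
    have key : ∀ (k₁ k₂ : J) (h : k₁ ≤ k₂) (hk₂ : k₂ < j),
        arrowMap (ofCocone (colimit.cocone (glue I))) k₁ k₂ h hk₂.le =
          arrowMap (I ⟨k₂, hk₂⟩).F k₁ k₂ h le_rfl := fun k₁ k₂ h hk₂ ↦ by
      rw [arrowMap_ofCocone _ _ _ _ hk₂]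
      exact arrow_glue I ⟨k₁, h.trans_lt hk₂⟩ ⟨k₂, hk₂⟩ h _ _
    obtain hij' | rfl := hij.lt_or_eq
    · rw [key _ _ _ hij', arrowMap_limit _ _ hi _ _ hk]
      have : restrictionLT (I ⟨i, hij'⟩).F le_rfl =
          restrictionLT (ofCocone (colimit.cocone (glue I))) hij :=
        Arrow.functor_ext fun k₁ k₂ f ↦
          (congr_arrowMap (I ⟨i, hij'⟩) (I ⟨k₂.1, k₂.2.trans hij'⟩) (leOfHom f) k₂.2.le
            le_rfl).trans (key k₁.1 k₂.1 (leOfHom f) (k₂.2.trans hij')).symm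
      rw [this]
    · rw [arrowMap_ofCocone_to_top _ _ hk]
      have : glue I = restrictionLT (ofCocone (colimit.cocone (glue I))) hij :=
        Arrow.functor_ext fun k₁ k₂ f ↦
          (arrow_glue I k₁ k₂ (leOfHom f) _ _).trans (key k₁.1 k₂.1 (leOfHom f) k₂.2).symm
      exact congr_arg (fun G : Set.Iio i ⥤ D ↦ ιArrow G k hk) this

variable (Φ) in
lemma nonempty (j : J) : Nonempty (IterationUpTo Φ j) := by
  induction j using SuccOrder.limitRecOn with
  | isMin i hi =>
      obtain rfl : i = ⊥ := by simpa using hi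
      exact ⟨mkOfBot Φ J⟩
  | succ i hi hi' => exact ⟨mkOfSucc hi hi'.some⟩
  | isSuccLimit i hi hi' => exact ⟨mkOfLimit hi (fun a ↦ (hi' a.1 a.2).some)⟩

end IterationUpTo

open IterationUpTo

-- Equality of arrows forces the cone point to equal the chosen colimit; the arrow from `⊥` exhibits
-- this, and the resulting isomorphism respects all inclusions.
omit [SuccOrder J] in
lemma nonempty_isColimit_of_arrow_eq {i : J} (hi : Order.IsSuccLimit i) {G : Set.Iio i ⥤ D}
    (c : Cocone G) (h : ∀ k : Set.Iio i, Arrow.mk (c.ι.app k) = ιArrow G k.1 k.2) :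
    Nonempty (IsColimit c) := by
  have hpt : colimit G = c.pt := (congr_arg Comma.right (h ⟨⊥, hi.bot_lt⟩)).symm
  exact ⟨IsColimit.ofIsoColimit (colimit.isColimit G)
    (Cocone.ext (eqToIso hpt) fun k ↦ Arrow.mk_injective _ _ (by
      rw [h k]
      exact (Arrow.mk_eq_mk_iff _ _).2 ⟨rfl, hpt.symm, by simp⟩))⟩

/-- A successor structure can be iterated along a well-order as soon as there are colimits indexed
by its proper initial segments. -/
theorem exists_iteration [WellFoundedLT J] :
    ∃ F : J ⥤ D, F.IsWellOrderContinuous ∧ F.obj ⊥ = Φ.X₀ ∧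
      ∀ j : J, ¬IsMax j →
        Arrow.mk (F.map (homOfLE (Order.le_succ j))) = Φ.toSuccArrow (F.obj j) := by
  let I (j : J) : IterationUpTo Φ j := (IterationUpTo.nonempty Φ j).some
  let t : J → (Set.univ : Set J) := fun j ↦ ⟨j, trivial⟩
  have ht : Monotone t := fun _ _ h ↦ h
  -- The value at `j` is the top of the iteration of length `j`, so no colimit over all of `J` is
  -- formed.
  let F : J ⥤ D := ht.functor ⋙ glue (s := Set.univ) fun i ↦ I i.1
  have hF (i₁ i₂ k : J) (h : i₁ ≤ i₂) (hk : i₂ ≤ k) :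
      Arrow.mk (F.map (homOfLE h)) = arrowMap (I k).F i₁ i₂ h hk :=
    arrow_glue (s := Set.univ) (fun i ↦ I i.1) (t i₁) (t i₂) h (I k) hk
  refine ⟨F, ⟨fun m hm ↦ ?_⟩, (I ⊥).obj_bot, fun j hj ↦ ?_⟩
  · refine nonempty_isColimit_of_arrow_eq hm _ fun k ↦ ?_
    refine (hF k.1 m m k.2.le le_rfl).trans (((I m).arrowMap_limit m hm le_rfl k.1 k.2).trans ?_)
    have : restrictionLT (I m).F le_rfl = (Set.principalSegIio m).monotone.functor ⋙ F :=
      Arrow.functor_ext fun k₁ k₂ f ↦ (hF k₁.1 k₂.1 m (leOfHom f) k₂.2.le).symm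
    rw [this]
  · have h := (hF j (Order.succ j) _ (Order.le_succ j) le_rfl).trans
      ((I (Order.succ j)).arrowSucc_eq j (Order.lt_succ_of_not_isMax hj))
    have hj' : (I (Order.succ j)).F.obj ⟨j, Order.le_succ j⟩ = F.obj j :=
      congr_obj (I (Order.succ j)) (I j) j (Order.le_succ j) le_rfl
    rwa [hj'] at h

end Iteration

/-! ### The category of stages and its colimits -/

section Stages

variable {C : Type u} [Category.{v} C]

/-- A stage in the construction of an algebraic chain: two successive objects `A` and `B`, a
connecting map `j` and a structure map `x`. -/
structure Stage (T : C ⥤ C) where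
  A : C
  B : C
  j : A ⟶ B
  x : T.obj A ⟶ B

namespace Stage

variable {T : C ⥤ C}

/-- Morphisms of stages commute with the connecting maps and the structure maps. -/
@[ext]
structure Hom (P Q : Stage T) where
  a : P.A ⟶ Q.A
  b : P.B ⟶ Q.B
  hj : P.j ≫ b = a ≫ Q.j
  hx : P.x ≫ b = T.map a ≫ Q.x

attribute [simp] Hom.hj Hom.hx

@[simp]
lemma Hom.hj_assoc {P Q : Stage T} (f : Hom P Q) {Z : C} (h : Q.B ⟶ Z) :
    P.j ≫ f.b ≫ h = f.a ≫ Q.j ≫ h := by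
  rw [← Category.assoc, f.hj, Category.assoc]

@[simp]
lemma Hom.hx_assoc {P Q : Stage T} (f : Hom P Q) {Z : C} (h : Q.B ⟶ Z) :
    P.x ≫ f.b ≫ h = T.map f.a ≫ Q.x ≫ h := by
  rw [← Category.assoc, f.hx, Category.assoc]

instance : Category (Stage T) where
  Hom := Hom
  id P := { a := 𝟙 _, b := 𝟙 _, hj := by simp, hx := by simp }
  comp f g := { a := f.a ≫ g.a, b := f.b ≫ g.b, hj := by simp, hx := by simp }

@[ext]
lemma hom_ext {P Q : Stage T} {f g : P ⟶ Q} (ha : f.a = g.a) (hb : f.b = g.b) : f = g :=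
  Hom.ext ha hb

@[simp] lemma comp_a {P Q R : Stage T} (f : P ⟶ Q) (g : Q ⟶ R) :
    (f ≫ g).a = f.a ≫ g.a := rfl
@[simp] lemma comp_b {P Q R : Stage T} (f : P ⟶ Q) (g : Q ⟶ R) :
    (f ≫ g).b = f.b ≫ g.b := rfl

variable (T) in
/-- The functor sending a stage to its first object. -/
@[simps]
def fst : Stage T ⥤ C where
  obj P := P.A
  map f := f.a

variable (T) in
/-- The functor sending a stage to its second object. -/
@[simps]
def snd : Stage T ⥤ C where
  obj P := P.B
  map f := f.b

end Stage

lemma exists_colimit {J : Type*} [Category* J] [HasColimitsOfShape J C] (G : J ⥤ C) :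
    ∃ (Z : C) (a : ∀ i, G.obj i ⟶ Z), (∀ {i i' : J} (f : i ⟶ i'), G.map f ≫ a i' = a i) ∧
      (∀ {W : C} (t : ∀ i, G.obj i ⟶ W), (∀ {i i' : J} (f : i ⟶ i'), G.map f ≫ t i' = t i) →
        ∃ d : Z ⟶ W, ∀ i, a i ≫ d = t i) ∧
      ∀ {W : C} (d d' : Z ⟶ W), (∀ i, a i ≫ d = a i ≫ d') → d = d' :=
  ⟨colimit G, colimit.ι G, colimit.w G, fun t ht ↦
    ⟨colimit.desc G ⟨_, { app := t, naturality := fun _ _ f ↦ by simpa using ht f }⟩,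
      fun i ↦ by simp⟩, fun _ _ h ↦ colimit.hom_ext h⟩

namespace Stage

variable {T : C ⥤ C} {J : Type*} [Category* J] [HasColimitsOfShape J C] [HasPushouts C]

/-- Colimits of stages exist: the first object is a colimit and the second one is a pushout of
colimits. -/
lemma exists_isColimit (K : J ⥤ Stage T) :
    ∃ c : Cocone K, Nonempty (IsColimit c) ∧ Nonempty (IsColimit ((fst T).mapCocone c)) := by
  obtain ⟨A, a, ha, descA, extA⟩ : ∃ (A : C) (a : ∀ i, (K.obj i).A ⟶ A),
      (∀ {i i' : J} (f : i ⟶ i'), (K.map f).a ≫ a i' = a i) ∧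
      (∀ {W : C} (t : ∀ i, (K.obj i).A ⟶ W), (∀ {i i' : J} (f : i ⟶ i'),
        (K.map f).a ≫ t i' = t i) → ∃ d : A ⟶ W, ∀ i, a i ≫ d = t i) ∧
      ∀ {W : C} (d d' : A ⟶ W), (∀ i, a i ≫ d = a i ≫ d') → d = d' :=
    exists_colimit (K ⋙ fst T)
  obtain ⟨B, b, hb, descB, extB⟩ : ∃ (B : C) (b : ∀ i, (K.obj i).B ⟶ B),
      (∀ {i i' : J} (f : i ⟶ i'), (K.map f).b ≫ b i' = b i) ∧
      (∀ {W : C} (t : ∀ i, (K.obj i).B ⟶ W), (∀ {i i' : J} (f : i ⟶ i'),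
        (K.map f).b ≫ t i' = t i) → ∃ d : B ⟶ W, ∀ i, b i ≫ d = t i) ∧
      ∀ {W : C} (d d' : B ⟶ W), (∀ i, b i ≫ d = b i ≫ d') → d = d' :=
    exists_colimit (K ⋙ snd T)
  obtain ⟨Z, z, -, descZ, extZ⟩ : ∃ (Z : C) (z : ∀ i, T.obj (K.obj i).A ⟶ Z),
      (∀ {i i' : J} (f : i ⟶ i'), T.map (K.map f).a ≫ z i' = z i) ∧
      (∀ {W : C} (t : ∀ i, T.obj (K.obj i).A ⟶ W), (∀ {i i' : J} (f : i ⟶ i'),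
        T.map (K.map f).a ≫ t i' = t i) → ∃ d : Z ⟶ W, ∀ i, z i ≫ d = t i) ∧
      ∀ {W : C} (d d' : Z ⟶ W), (∀ i, z i ≫ d = z i ≫ d') → d = d' :=
    exists_colimit (K ⋙ fst T ⋙ T)
  -- `T` need not preserve the colimit `A`: `p` compares the colimit `Z` of the `T A_i` with `T A`,
  -- and `q` sends it to the colimit of the `B_i`. Their pushout is the universal second object.
  obtain ⟨p, hp⟩ := descZ (fun i ↦ T.map (a i)) fun f ↦ by rw [← T.map_comp, ha]
  obtain ⟨q, hq⟩ := descZ (fun i ↦ (K.obj i).x ≫ b i) fun f ↦ by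
    rw [← Hom.hx_assoc, hb]
  obtain ⟨j, hj⟩ := descA (fun i ↦ (K.obj i).j ≫ b i) fun f ↦ by
    rw [← Hom.hj_assoc, hb]
  let c : Cocone K :=
    { pt := ⟨A, pushout p q, j ≫ pushout.inr p q, pushout.inl p q⟩
      ι :=
        { app i :=
            { a := a i
              b := b i ≫ pushout.inr p q
              hj := by simp [reassoc_of% hj]
              hx := by simp [← reassoc_of% hp, ← reassoc_of% hq, pushout.condition] }
          naturality i i' f := by
            ext
            · exact (ha f).trans (Category.comp_id _).symm
            · exact ((Category.assoc _ _ _).symm.trans (congr_arg (· ≫ pushout.inr p q) (hb f))).trans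
                (Category.comp_id _).symm } }
  refine ⟨c, ⟨?_⟩, ⟨?_⟩⟩
  · have h (s : Cocone K) : ∃ m : c.pt ⟶ s.pt, ∀ i, c.ι.app i ≫ m = s.ι.app i := by
      obtain ⟨d, hd⟩ := descA (W := s.pt.A) (fun i ↦ (s.ι.app i).a) fun f ↦
        congr_arg Hom.a (s.w f)
      obtain ⟨e, he⟩ := descB (W := s.pt.B) (fun i ↦ (s.ι.app i).b) fun f ↦
        congr_arg Hom.b (s.w f)
      have hde : p ≫ T.map d ≫ s.pt.x = q ≫ e := extZ _ _ fun i ↦ by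
        rw [reassoc_of% hp, reassoc_of% hq, he, ← T.map_comp_assoc, hd]
        exact ((s.ι.app i).hx).symm
      refine ⟨{ a := d
                b := pushout.desc (T.map d ≫ s.pt.x) e hde
                hj := ?_
                hx := pushout.inl_desc _ _ _ }, fun i ↦ ?_⟩
      · refine extA _ _ fun i ↦ ?_
        simp only [c, Category.assoc, pushout.inr_desc, reassoc_of% hj, he, reassoc_of% hd]
        exact (s.ι.app i).hj
      · ext
        · exact hd i
        · exact (Category.assoc _ _ _).trans
            ((congr_arg (b i ≫ ·) (pushout.inr_desc _ _ _)).trans (he i))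
    choose m hm using h
    refine { desc := m, fac := hm, uniq := fun s m' hm' ↦ ?_ }
    have e : m'.a = (m s).a := extA _ _ fun i ↦
      (congr_arg Hom.a (hm' i)).trans (congr_arg Hom.a (hm s i)).symm
    refine hom_ext e (pushout.hom_ext ?_ (extB _ _ fun i ↦ ?_))
    · exact m'.hx.trans ((congr_arg (fun t ↦ T.map t ≫ s.pt.x) e).trans (m s).hx.symm)
    · exact ((Category.assoc _ _ _).symm.trans (congr_arg Hom.b (hm' i))).trans
        ((Category.assoc _ _ _).symm.trans (congr_arg Hom.b (hm s i))).symm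
  · have h (s : Cocone (K ⋙ fst T)) : ∃ m : A ⟶ s.pt, ∀ i, a i ≫ m = s.ι.app i :=
      descA (fun i ↦ s.ι.app i) fun f ↦ s.w f
    choose m hm using h
    exact { desc := m, fac := hm, uniq := fun s m' hm' ↦ extA _ _ fun i ↦
      (hm' i).trans (hm s i).symm }

instance : HasColimitsOfShape J (Stage T) where
  has_colimit K :=
    let ⟨c, ⟨hc⟩, _⟩ := exists_isColimit K
    ⟨⟨⟨c, hc⟩⟩⟩

instance : PreservesColimitsOfShape J (fst T) where
  preservesColimit {K} :=
    let ⟨_, ⟨hc⟩, ⟨hc'⟩⟩ := exists_isColimit K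
    preservesColimit_of_preserves_colimit_cocone hc hc'

end Stage

end Stages

/-! ### The successor of a stage -/

section NextStage

variable {C : Type u} [Category.{v} C] {T T₂ : C ⥤ C}

lemma exists_isJointCoequaliserTwo [HasColimitsOfShape WalkingParallelPair C]
    [HasBinaryCoproducts C] {A A' B : C} (f g : A ⟶ B) (f' g' : A' ⟶ B) :
    ∃ (Q : C) (p : B ⟶ Q), IsJointCoequaliserTwo f g f' g' p := by
  have hw := coequalizer.condition (coprod.desc f f') (coprod.desc g g')
  refine ⟨_, coequalizer.π (coprod.desc f f') (coprod.desc g g'), ⟨?_, ?_⟩, fun h h₁ h₂ ↦ ?_⟩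
  · have := coprod.inl ≫= hw
    rwa [coprod.inl_desc_assoc, coprod.inl_desc_assoc] at this
  · have := coprod.inr ≫= hw
    rwa [coprod.inr_desc_assoc, coprod.inr_desc_assoc] at this
  · refine ⟨coequalizer.desc h (by ext <;> simp [h₁, h₂]), by simp, fun k hk ↦ ?_⟩
    exact coequalizer.hom_ext (by simpa using hk)

variable (η : 𝟭 C ⟶ T) (γ : T₂ ⟶ T) (lam : T₂ ⟶ T ⋙ T)

/-- The stage `Q` follows the stage `P`, as witnessed by the morphism `f` and by the coequaliser
`π` which makes the connecting map of `P` equal to the structure map composed with `η`. -/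
structure IsNextStage {P Q : Stage T} (f : P ⟶ Q) (π : P.B ⟶ Q.A) : Prop where
  w : η.app P.A ≫ P.x ≫ π = P.j ≫ π
  desc : ∀ {Z : C} (h : P.B ⟶ Z), η.app P.A ≫ P.x ≫ h = P.j ≫ h → ∃! k : Q.A ⟶ Z, π ≫ k = h
  fst_eq : f.a = P.j ≫ π
  snd_eq : f.b = π ≫ Q.j
  j_eq : Q.j = η.app Q.A ≫ Q.x
  step : IsJointCoequaliserTwo
    (T.map (η.app P.A) ≫ T.map (P.x ≫ π)) (η.app (T.obj P.A) ≫ T.map (P.x ≫ π))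
    (lam.app P.A ≫ T.map (P.x ≫ π)) (γ.app P.A ≫ T.map (P.j ≫ π)) Q.x

lemma exists_isNextStage [HasColimitsOfShape WalkingParallelPair C] [HasBinaryCoproducts C]
    (P : Stage T) :
    ∃ (Q : Stage T) (f : P ⟶ Q) (π : P.B ⟶ Q.A), IsNextStage η γ lam f π := by
  let π := coequalizer.π (η.app P.A ≫ P.x) P.j
  have hw : η.app P.A ≫ P.x ≫ π = P.j ≫ π := by
    simpa using coequalizer.condition (η.app P.A ≫ P.x) P.j
  obtain ⟨Q, q, hq⟩ := exists_isJointCoequaliserTwo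
    (T.map (η.app P.A) ≫ T.map (P.x ≫ π)) (η.app (T.obj P.A) ≫ T.map (P.x ≫ π))
    (lam.app P.A ≫ T.map (P.x ≫ π)) (γ.app P.A ≫ T.map (P.j ≫ π))
  let Q' : Stage T := ⟨_, Q, η.app _ ≫ q, q⟩
  let f : P ⟶ Q' :=
    { a := P.j ≫ π
      b := π ≫ η.app _ ≫ q
      hj := by simp [Q']
      hx := by
        -- By naturality of `η` and the equation for `π`, the first parallel pair says exactly that
        -- `f` respects the structure maps.
        have h := hq.1.1
        have hη := η.naturality (P.x ≫ π)
        simp only [Functor.id_obj, Functor.id_map] at hη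
        rw [← hη, ← T.map_comp, hw] at h
        simpa [Q'] using h.symm }
  refine ⟨Q', f, π, hw, fun h hh ↦ ⟨coequalizer.desc h (by simpa using hh), ?_, fun k hk ↦ ?_⟩,
    rfl, rfl, rfl, hq⟩
  · simp [π]
  · exact coequalizer.hom_ext (by simpa using hk)

/-- The successor structure on stages whose iteration is the free special algebraic chain. -/
noncomputable def stageSuccStruct [HasColimitsOfShape WalkingParallelPair C]
    [HasBinaryCoproducts C] (X : C) : SmallObject.SuccStruct (Stage T) where
  X₀ := ⟨X, T.obj X, η.app X, 𝟙 _⟩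
  succ P := (exists_isNextStage η γ lam P).choose
  toSucc P := (exists_isNextStage η γ lam P).choose_spec.choose

/-- The equalities of objects from the iteration are traded here for isomorphisms and universal
properties, which are all that is used later. -/
lemma exists_stages [HasColimitsOfSize.{w, w} C] (X : C) :
    ∃ F : Ordinal.{w} ⥤ Stage T, F.IsWellOrderContinuous ∧ Nonempty (X ≅ (F.obj 0).A) ∧
      (IsIso (F.obj 0).x ∧ (F.obj 0).j = η.app _ ≫ (F.obj 0).x) ∧
      ∀ n : Ordinal.{w}, ∃ π : (F.obj n).B ⟶ (F.obj (n + 1)).A,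
        IsNextStage η γ lam (F.map (homOfLE (le_self_add : n ≤ n + 1))) π := by
  have (j : Ordinal.{w}) : HasColimitsOfShape (Set.Iio j) C :=
    hasColimitsOfShape_of_essentiallySmall.{w} _ _
  have : HasPushouts C := hasColimitsOfShape_of_essentiallySmall.{w} _ _
  have : HasBinaryCoproducts C := hasColimitsOfShape_of_essentiallySmall.{w} _ _
  have : HasColimitsOfShape WalkingParallelPair C := hasColimitsOfShape_of_essentiallySmall.{w} _ _
  obtain ⟨F, hF, h₀, hs⟩ := exists_iteration (J := Ordinal.{w}) (stageSuccStruct η γ lam X)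
  refine ⟨F, hF, ⟨(Stage.fst T).mapIso (eqToIso h₀.symm)⟩, ?_, fun n ↦ ?_⟩
  · have : ∀ P : Stage T, P = ⟨X, T.obj X, η.app X, 𝟙 _⟩ → IsIso P.x ∧ P.j = η.app _ ≫ P.x := by
      rintro _ rfl
      exact ⟨inferInstanceAs (IsIso (𝟙 _)), (Category.comp_id _).symm⟩
    exact this _ h₀
  · have h : ∀ f : Arrow (Stage T), f = (stageSuccStruct η γ lam X).toSuccArrow (F.obj n) →
        ∃ π : f.left.B ⟶ f.right.A, IsNextStage η γ lam f.hom π := by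
      rintro _ rfl
      exact (exists_isNextStage η γ lam (F.obj n)).choose_spec.choose_spec
    exact h _ (hs n (not_isMax n))

end NextStage

/-! ### Calculus of connecting maps -/

namespace AlgebraicChain

variable {C : Type u} [Category.{v} C] {T : C ⥤ C} {η : 𝟭 C ⟶ T} (S : AlgebraicChain.{w} η)

@[simp]
lemma j_comp {k n m : Ordinal.{w}} (h : k ≤ n) (h' : n ≤ m) :
    S.j h ≫ S.j h' = S.j (h.trans h') := by
  rw [j, j, j, ← S.X.map_comp, homOfLE_comp]

@[simp]
lemma j_comp_assoc {k n m : Ordinal.{w}} (h : k ≤ n) (h' : n ≤ m) {Z : C} (f : S.X.obj m ⟶ Z) :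
    S.j h ≫ S.j h' ≫ f = S.j (h.trans h') ≫ f := by
  rw [← Category.assoc, j_comp]

@[simp]
lemma j_self (n : Ordinal.{w}) (h : n ≤ n) : S.j h = 𝟙 _ := S.X.map_id n

@[simp]
lemma unit_x (n : Ordinal.{w}) : η.app (S.X.obj n) ≫ S.x n = S.j le_self_add := S.unit n

@[simp]
lemma unit_x_assoc (n : Ordinal.{w}) {Z : C} (f : S.X.obj (n + 1) ⟶ Z) :
    η.app (S.X.obj n) ≫ S.x n ≫ f = S.j le_self_add ≫ f := by
  rw [← unit_x, Category.assoc]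

lemma map_j_x {n m : Ordinal.{w}} (h : n ≤ m) :
    T.map (S.j h) ≫ S.x m = S.x n ≫ S.j (add_le_add_left h 1 : n + 1 ≤ m + 1) := by
  obtain h | rfl := h.lt_or_eq
  · exact S.compat h
  · simp

lemma map_j_x_assoc {n m : Ordinal.{w}} (h : n ≤ m) {Z : C} (f : S.X.obj (m + 1) ⟶ Z) :
    T.map (S.j h) ≫ S.x m ≫ f = S.x n ≫ S.j (add_le_add_left h 1 : n + 1 ≤ m + 1) ≫ f := by
  rw [← Category.assoc, map_j_x, Category.assoc]

end AlgebraicChain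

/-! ### Existence of X⋆ -/

section StarChain

variable {C : Type u} [Category.{v} C] {T T₂ : C ⥤ C}
  {η : 𝟭 C ⟶ T} {γ : T₂ ⟶ T} {lam : T₂ ⟶ T ⋙ T}

lemma IsJointCoequaliserTwo.comp_isIso {A A' B Q Q' : C} {f g : A ⟶ B} {f' g' : A' ⟶ B}
    {p : B ⟶ Q} (hp : IsJointCoequaliserTwo f g f' g' p) (e : Q ⟶ Q') [IsIso e] :
    IsJointCoequaliserTwo f g f' g' (p ≫ e) := by
  refine ⟨⟨by simp [reassoc_of% hp.1.1], by simp [reassoc_of% hp.1.2]⟩, fun h h₁ h₂ ↦ ?_⟩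
  obtain ⟨k, hk, hu⟩ := hp.2 h h₁ h₂
  refine ⟨inv e ≫ k, by simpa using hk, fun k' hk' ↦ ?_⟩
  rw [← hu (e ≫ k') (by simpa using hk'), IsIso.inv_hom_id_assoc]

namespace IsNextStage

variable {P Q : Stage T} {f : P ⟶ Q} {π : P.B ⟶ Q.A} (h : IsNextStage η γ lam f π)

-- When j = x ∘ η already holds, `π` coequalises two equal maps.
include h in
lemma isIso (hP : P.j = η.app P.A ≫ P.x) : IsIso π := by
  obtain ⟨k, hk, -⟩ := h.desc (𝟙 _) (by simpa using hP.symm)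
  have : Epi π := ⟨fun a b hab ↦ by
    obtain ⟨c, -, hc⟩ := h.desc (π ≫ a) (by simp only [reassoc_of% h.w])
    rw [hc a rfl, hc b hab.symm]⟩
  exact ⟨k, hk, by rw [← cancel_epi π, reassoc_of% hk, Category.comp_id]⟩

end IsNextStage

variable {F : Ordinal.{w} ⥤ Stage T} {π : ∀ n : Ordinal.{w}, (F.obj n).B ⟶ (F.obj (n + 1)).A}

/-- The second component at a strict inequality passes through the first object of stage n + 1, so
it is governed by the chain of first objects. -/
lemma snd_map_of_isNextStage
    (hπ : ∀ n : Ordinal.{w}, IsNextStage η γ lam (F.map (homOfLE (le_self_add : n ≤ n + 1))) (π n))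
    {n m : Ordinal.{w}} (h : n < m) : (F.map (homOfLE h.le)).b =
      π n ≫ (F.map (homOfLE (Order.add_one_le_of_lt h))).a ≫ (F.obj m).j := by
  rw [← homOfLE_comp le_self_add (Order.add_one_le_of_lt h), F.map_comp, Stage.comp_b,
    (hπ n).snd_eq, Category.assoc, Stage.Hom.hj]

/-- The algebraic chain formed by the first objects of a chain of stages. -/
def chainOfStages
    (hπ : ∀ n : Ordinal.{w}, IsNextStage η γ lam (F.map (homOfLE (le_self_add : n ≤ n + 1))) (π n)) :
    AlgebraicChain.{w} η where
  X := F ⋙ Stage.fst T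
  x n := (F.obj n).x ≫ π n
  unit n := (hπ n).w.trans (hπ n).fst_eq.symm
  compat {n m} h := by
    have h₁ := (F.map (homOfLE h.le)).hx
    have h₂ : (F.map (homOfLE (add_le_add_left h.le 1 : n + 1 ≤ m + 1))).a =
        (F.map (homOfLE (Order.add_one_le_of_lt h))).a ≫ (F.obj m).j ≫ π m := by
      rw [← (hπ m).fst_eq, ← Stage.comp_a, ← F.map_comp, homOfLE_comp]
    change T.map (F.map (homOfLE h.le)).a ≫ (F.obj m).x ≫ π m = ((F.obj n).x ≫ π n) ≫
      (F.map (homOfLE (add_le_add_left h.le 1 : n + 1 ≤ m + 1))).a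
    rw [← reassoc_of% h₁, h₂, snd_map_of_isNextStage hπ h]
    simp only [Category.assoc]

variable (hπ : ∀ n : Ordinal.{w}, IsNextStage η γ lam (F.map (homOfLE (le_self_add : n ≤ n + 1))) (π n))

lemma chainOfStages_step (n : Ordinal.{w}) : IsJointCoequaliserTwo
    (T.map (η.app ((chainOfStages hπ).X.obj n)) ≫ T.map ((chainOfStages hπ).x n))
    (η.app (T.obj ((chainOfStages hπ).X.obj n)) ≫ T.map ((chainOfStages hπ).x n))
    (lam.app ((chainOfStages hπ).X.obj n) ≫ T.map ((chainOfStages hπ).x n))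
    (γ.app ((chainOfStages hπ).X.obj n) ≫ T.map ((chainOfStages hπ).j (le_self_add : n ≤ n + 1)))
    ((chainOfStages hπ).x (n + 1)) := by
  have := (hπ (n + 1)).isIso (hπ n).j_eq
  have h := (hπ n).step.comp_isIso (π (n + 1))
  rw [← (hπ n).fst_eq] at h
  exact h

lemma chainOfStages_isSpecialChain : IsSpecialChain.{w} η γ lam (chainOfStages hπ) := by
  intro n
  have h := (chainOfStages_step hπ n).1.2
  have h' := (chainOfStages hπ).compat (lt_add_one n)
  simp only [Category.assoc] at h
  rw [h]
  exact congr_arg (γ.app _ ≫ ·) h'.symm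

/-- A map `h` equalising all the pairs makes `Z` the second object of a stage over X_m, and the
equations on `h` give a cocone from the earlier stages. The induced map out of the colimit stage is
the identity on X_m, and its second component descends along `π m`. -/
lemma chainOfStages_limit_step [HasColimitsOfSize.{w, w} C] [F.IsWellOrderContinuous]
    (m : Ordinal.{w}) (hm : Order.IsSuccLimit m) :
    IsJointCoequaliser (A := fun n : Set.Iio m => T.obj ((chainOfStages hπ).X.obj n))
      (fun n => T.map ((chainOfStages hπ).j (le_of_lt n.2)))
      (fun n => (chainOfStages hπ).x n ≫ (chainOfStages hπ).j (Order.add_one_le_of_lt n.2) ≫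
        η.app ((chainOfStages hπ).X.obj m))
      ((chainOfStages hπ).x m) := by
  have key : ∀ {n : Ordinal.{w}} (h : n < m),
      T.map ((chainOfStages hπ).j h.le) ≫ (chainOfStages hπ).x m =
        (chainOfStages hπ).x n ≫ (chainOfStages hπ).j (Order.add_one_le_of_lt h) ≫
          η.app ((chainOfStages hπ).X.obj m) ≫ (chainOfStages hπ).x m := fun h ↦ by
    rw [(chainOfStages hπ).map_j_x, (chainOfStages hπ).unit_x, (chainOfStages hπ).j_comp]
  refine ⟨fun n ↦ by simpa using key n.2, fun {Z} h hh ↦ ?_⟩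
  change T.obj (F.obj m).A ⟶ Z at h
  have (m : Ordinal.{w}) : HasColimitsOfShape (Set.Iio m) C :=
    hasColimitsOfShape_of_essentiallySmall.{w} _ _
  have : HasPushouts C := hasColimitsOfShape_of_essentiallySmall.{w} _ _
  have hc := F.isColimitOfIsWellOrderContinuous m hm
  have extA {W : C} (u u' : (F.obj m).A ⟶ W)
      (hu : ∀ (n) (hn : n < m), (F.map (homOfLE hn.le)).a ≫ u = (F.map (homOfLE hn.le)).a ≫ u') :
      u = u' :=
    (isColimitOfPreserves (Stage.fst T) hc).hom_ext fun n ↦ hu n.1 n.2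
  let P : Stage T := ⟨(F.obj m).A, Z, η.app _ ≫ h, h⟩
  have hh' (n : Ordinal.{w}) (hn : n < m) : T.map (F.map (homOfLE hn.le)).a ≫ h =
      (F.obj n).x ≫ π n ≫ (F.map (homOfLE (Order.add_one_le_of_lt hn))).a ≫ η.app _ ≫ h := by
    refine (hh ⟨n, hn⟩).trans ?_
    change (((F.obj n).x ≫ π n) ≫ (F.map (homOfLE (Order.add_one_le_of_lt hn))).a ≫
      η.app (F.obj m).A) ≫ h = _
    simp only [Category.assoc]
  have ha {n n' : Ordinal.{w}} (hn : n ≤ n') (hn' : n' < m) :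
      (F.map (homOfLE hn)).a ≫ (F.map (homOfLE hn'.le)).a =
        (F.map (homOfLE (hn.trans hn'.le))).a := by
    rw [← Stage.comp_a, ← F.map_comp, homOfLE_comp]
  have ha' (n : Ordinal.{w}) (hn : n < m) : (F.obj n).j ≫ π n ≫
      (F.map (homOfLE (Order.add_one_le_of_lt hn))).a = (F.map (homOfLE hn.le)).a := by
    rw [← ha le_self_add (hm.add_one_lt hn), (hπ n).fst_eq, Category.assoc]
  let t (n : Ordinal.{w}) (hn : n < m) : F.obj n ⟶ P :=
    { a := (F.map (homOfLE hn.le)).a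
      b := π n ≫ (F.map (homOfLE (Order.add_one_le_of_lt hn))).a ≫ η.app _ ≫ h
      hj := by rw [reassoc_of% ha' n hn]
      hx := (hh' n hn).symm }
  have ht {n n' : Ordinal.{w}} (hn : n ≤ n') (hn' : n' < m) :
      F.map (homOfLE hn) ≫ t n' hn' = t n (hn.trans_lt hn') := by
    obtain hlt | rfl := hn.lt_or_eq
    · refine Stage.hom_ext (ha hn hn') ?_
      rw [Stage.comp_b, snd_map_of_isNextStage hπ hlt]
      simp only [t, Category.assoc, reassoc_of% ha' n' hn',
        reassoc_of% ha (Order.add_one_le_of_lt hlt) hn']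
    · exact (congr_arg (· ≫ t n hn') (F.map_id n)).trans (Category.id_comp _)
  let c : Cocone ((Set.principalSegIio m).monotone.functor ⋙ F) :=
    { pt := P
      ι := { app n := t n.1 n.2
             naturality _ n' f := (ht (leOfHom f) n'.2).trans (Category.comp_id _).symm } }
  obtain ⟨d, hd⟩ : ∃ d : F.obj m ⟶ P, ∀ (n) (hn : n < m), F.map (homOfLE hn.le) ≫ d = t n hn :=
    ⟨hc.desc c, fun n hn ↦ hc.fac c ⟨n, hn⟩⟩
  have ext {d d' : F.obj m ⟶ P} (h : ∀ (n) (hn : n < m),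
      F.map (homOfLE hn.le) ≫ d = F.map (homOfLE hn.le) ≫ d') : d = d' :=
    hc.hom_ext fun n ↦ h n.1 n.2
  have hda : d.a = 𝟙 (F.obj m).A := extA _ _ fun n hn ↦
    (congr_arg Stage.Hom.a (hd n hn)).trans (Category.comp_id _).symm
  have hdx : (F.obj m).x ≫ d.b = h := by
    refine d.hx.trans ?_
    rw [hda]
    exact (congr_arg (· ≫ h) (T.map_id _)).trans (Category.id_comp _)
  have hdj : (F.obj m).j ≫ d.b = η.app _ ≫ h := by
    refine d.hj.trans ?_
    rw [hda]
    exact Category.id_comp _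
  obtain ⟨k, hk, hku⟩ := (hπ m).desc d.b (by rw [hdx, hdj])
  refine ⟨k, (Category.assoc _ _ _).trans ((congr_arg _ hk).trans hdx), fun k' hk' ↦ hku k' ?_⟩
  change (F.obj (m + 1)).A ⟶ Z at k'
  replace hk' : (F.obj m).x ≫ π m ≫ k' = h := (Category.assoc _ _ _).symm.trans hk'
  have hk'' : (F.obj m).j ≫ π m ≫ k' = η.app _ ≫ h := by
    rw [← hk', ← Category.assoc, ← (hπ m).w]
    simp only [Category.assoc]
  -- For uniqueness, a second factorisation `k'` is repackaged as a morphism of stages, so that the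
  -- universal property of the colimit stage applies.
  let d' : F.obj m ⟶ P :=
    { a := 𝟙 _
      b := π m ≫ k'
      hj := hk''.trans (Category.id_comp _).symm
      hx := by
        rw [T.map_id]
        exact hk'.trans (Category.id_comp _).symm }
  refine congr_arg Stage.Hom.b (ext (d := d') fun n hn ↦ (Eq.trans ?_ (hd n hn).symm))
  refine Stage.hom_ext (Category.comp_id _) ?_
  change (F.map (homOfLE hn.le)).b ≫ π m ≫ k' =
    π n ≫ (F.map (homOfLE (Order.add_one_le_of_lt hn))).a ≫ η.app _ ≫ h
  rw [snd_map_of_isNextStage hπ hn, ← hk'']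
  simp only [Category.assoc]

theorem exists_isStarChain [HasColimitsOfSize.{w, w} C] (η : 𝟭 C ⟶ T) (γ : T₂ ⟶ T)
    (lam : T₂ ⟶ T ⋙ T) (X : C) :
    ∃ (S : SpecialChain.{w} η γ lam) (i : X ≅ S.obj.X.obj 0), IsStarChain X S i := by
  obtain ⟨F, hF, ⟨i⟩, ⟨h₀, h₁⟩, h⟩ := exists_stages η γ lam X
  choose π hπ using h
  refine ⟨⟨chainOfStages hπ, chainOfStages_isSpecialChain hπ⟩, i, ?_, chainOfStages_step hπ, ?_,
    chainOfStages_limit_step hπ⟩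
  · have := (hπ 0).isIso h₁
    exact inferInstanceAs (IsIso ((F.obj 0).x ≫ π 0))
  · have (m : Ordinal.{w}) : HasColimitsOfShape (Set.Iio m) C :=
      hasColimitsOfShape_of_essentiallySmall.{w} _ _
    have : HasPushouts C := hasColimitsOfShape_of_essentiallySmall.{w} _ _
    exact ⟨fun m hm ↦ ⟨isColimitOfPreserves (Stage.fst T)
      (F.isColimitOfIsWellOrderContinuous m hm)⟩⟩

end StarChain

/-! ### Freeness of X⋆ among special chains -/

section Free

variable {C : Type u} [Category.{v} C] {T T₂ : C ⥤ C}
  {η : 𝟭 C ⟶ T} {γ : T₂ ⟶ T} {lam : T₂ ⟶ T ⋙ T}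

lemma eq_zero_or_add_one_or_isSuccLimit (n : Ordinal.{w}) :
    n = 0 ∨ (∃ k, n = k + 1) ∨ Order.IsSuccLimit n := by
  rcases Ordinal.zero_or_succ_or_isSuccLimit n with h | ⟨k, h⟩ | h
  exacts [.inl h, .inr (.inl ⟨k, h.symm⟩), .inr (.inr h)]

namespace AlgebraicChain

lemma Hom.j_app {S R : AlgebraicChain.{w} η} (f : S ⟶ R) {n m : Ordinal.{w}} (h : n ≤ m) :
    S.j h ≫ f.f.app m = f.f.app n ≫ R.j h :=
  f.f.naturality _

lemma epi_family_of_isSuccLimit (S : AlgebraicChain.{w} η) [S.X.IsWellOrderContinuous]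
    {m : Ordinal.{w}} (hm : Order.IsSuccLimit m) {Z : C} {u v : S.X.obj m ⟶ Z}
    (h : ∀ (n) (hn : n < m), S.j hn.le ≫ u = S.j hn.le ≫ v) : u = v :=
  (S.X.isColimitOfIsWellOrderContinuous m hm).hom_ext fun n ↦ h n.1 n.2

lemma exists_desc_of_isSuccLimit (S : AlgebraicChain.{w} η) [S.X.IsWellOrderContinuous]
    {m : Ordinal.{w}} (hm : Order.IsSuccLimit m) {Z : C} (t : ∀ n, n < m → (S.X.obj n ⟶ Z))
    (ht : ∀ {n n'} (h : n ≤ n') (hn' : n' < m), S.j h ≫ t n' hn' = t n (h.trans_lt hn')) :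
    ∃ u : S.X.obj m ⟶ Z, ∀ (n) (hn : n < m), S.j hn.le ≫ u = t n hn := by
  let c : Cocone ((Set.principalSegIio m).monotone.functor ⋙ S.X) :=
    { pt := Z
      ι := { app n := t n.1 n.2
             naturality _ n' f := (ht (leOfHom f) n'.2).trans (Category.comp_id _).symm } }
  exact ⟨(S.X.isColimitOfIsWellOrderContinuous m hm).desc c,
    fun n hn ↦ (S.X.isColimitOfIsWellOrderContinuous m hm).fac c ⟨n, hn⟩⟩

/-- `IsComponent f n g` says that `g : S_n ⟶ R_n` is the `n`th component of a morphism of chains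
which extends `f : S_0 ⟶ R_0`. -/
inductive IsComponent {S R : AlgebraicChain.{w} η} (f : S.X.obj 0 ⟶ R.X.obj 0) :
    ∀ n : Ordinal.{w}, (S.X.obj n ⟶ R.X.obj n) → Prop
  | mk (n : Ordinal.{w}) (g : S.X.obj n ⟶ R.X.obj n)
      (g' : ∀ k, k < n → (S.X.obj k ⟶ R.X.obj k))
      (hg' : ∀ (k) (hk : k < n), IsComponent f k (g' k hk))
      (h_zero : S.j (zero_le (a := n)) ≫ g = f ≫ R.j (zero_le (a := n)))
      (h_nat : ∀ (k) (hk : k < n), S.j hk.le ≫ g = g' k hk ≫ R.j hk.le)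
      (h_x : ∀ (k) (hk : k < n), S.x k ≫ S.j (Order.add_one_le_of_lt hk) ≫ g =
        T.map (g' k hk) ≫ R.x k ≫ R.j (Order.add_one_le_of_lt hk)) : IsComponent f n g

lemma IsComponent.spec {S R : AlgebraicChain.{w} η} {f : S.X.obj 0 ⟶ R.X.obj 0} {n : Ordinal.{w}}
    {g : S.X.obj n ⟶ R.X.obj n} (h : IsComponent f n g) :
    S.j (zero_le (a := n)) ≫ g = f ≫ R.j (zero_le (a := n)) ∧
    ∀ (k) (hk : k < n), ∃ g' : S.X.obj k ⟶ R.X.obj k, IsComponent f k g' ∧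
      S.j hk.le ≫ g = g' ≫ R.j hk.le ∧
      S.x k ≫ S.j (Order.add_one_le_of_lt hk) ≫ g =
        T.map g' ≫ R.x k ≫ R.j (Order.add_one_le_of_lt hk) := by
  cases h with
  | mk _ _ g' hg' h₀ hn hx => exact ⟨h₀, fun k hk ↦ ⟨g' k hk, hg' k hk, hn k hk, hx k hk⟩⟩

lemma IsComponent.of_spec {S R : AlgebraicChain.{w} η} {f : S.X.obj 0 ⟶ R.X.obj 0}
    {n : Ordinal.{w}} {g : S.X.obj n ⟶ R.X.obj n}
    (h₀ : S.j (zero_le (a := n)) ≫ g = f ≫ R.j (zero_le (a := n)))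
    (h : ∀ (k) (hk : k < n), ∃ g' : S.X.obj k ⟶ R.X.obj k, IsComponent f k g' ∧
      S.j hk.le ≫ g = g' ≫ R.j hk.le ∧
      S.x k ≫ S.j (Order.add_one_le_of_lt hk) ≫ g =
        T.map g' ≫ R.x k ≫ R.j (Order.add_one_le_of_lt hk)) : IsComponent f n g := by
  choose g' h₁ h₂ h₃ using h
  exact ⟨n, g, g', h₁, h₀, h₂, h₃⟩

end AlgebraicChain

open AlgebraicChain

namespace IsStarChain

variable {X : C} {S : SpecialChain.{w} η γ lam} {i : X ≅ S.obj.X.obj 0} (hS : IsStarChain X S i)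

include hS

lemma epi_x (n : Ordinal.{w}) : Epi (S.obj.x n) := by
  induction n using Ordinal.limitRecOn with
  | zero => have := hS.first; infer_instance
  | add_one n _ =>
    refine ⟨fun a b hab ↦ ?_⟩
    obtain ⟨c, -, hc⟩ := (hS.step n).2 (S.obj.x (n + 1) ≫ a)
      (by rw [← Category.assoc, (hS.step n).1.1, Category.assoc])
      (by rw [← Category.assoc, (hS.step n).1.2, Category.assoc])
    rw [hc a rfl, hc b hab.symm]
  | limit n hn _ =>
    refine ⟨fun a b hab ↦ ?_⟩
    obtain ⟨c, -, hc⟩ := (hS.limit_step n hn).2 (S.obj.x n ≫ a) (fun k ↦ by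
      have := (hS.limit_step n hn).1 k =≫ a
      simpa only [Category.assoc] using this)
    rw [hc a rfl, hc b hab.symm]

variable {R : AlgebraicChain.{w} η} {f : S.obj.X.obj 0 ⟶ R.X.obj 0}

/-- Components agree at 0 by definition, at successors because `x` is epi, and at limits because the
connecting maps are jointly epi. Uniqueness is what makes separately chosen components compatible,
both at limits and in the final natural transformation. -/
lemma isComponent_unique {n : Ordinal.{w}} {g₁ g₂ : S.obj.X.obj n ⟶ R.X.obj n}
    (h₁ : IsComponent f n g₁) (h₂ : IsComponent f n g₂) : g₁ = g₂ := by
  induction n using WellFoundedLT.induction with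
  | ind n ih =>
    have e (k) (hk : k < n) : S.obj.j hk.le ≫ g₁ = S.obj.j hk.le ≫ g₂ ∧
        S.obj.x k ≫ S.obj.j (Order.add_one_le_of_lt hk) ≫ g₁ =
          S.obj.x k ≫ S.obj.j (Order.add_one_le_of_lt hk) ≫ g₂ := by
      obtain ⟨g₁', hg₁, n₁, x₁⟩ := h₁.spec.2 k hk
      obtain ⟨g₂', hg₂, n₂, x₂⟩ := h₂.spec.2 k hk
      obtain rfl := ih k hk hg₁ hg₂
      exact ⟨n₁.trans n₂.symm, x₁.trans x₂.symm⟩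
    rcases eq_zero_or_add_one_or_isSuccLimit n with rfl | ⟨k, rfl⟩ | hn
    · simpa using h₁.spec.1.trans h₂.spec.1.symm
    · have := hS.epi_x k
      have h := (e k (lt_add_one k)).2
      rw [cancel_epi] at h
      simpa using h
    · have := hS.limit
      exact S.obj.epi_family_of_isSuccLimit hn fun k hk ↦ (e k hk).1

lemma isComponent_nat {n m : Ordinal.{w}} (h : n ≤ m) {g : S.obj.X.obj n ⟶ R.X.obj n}
    {g' : S.obj.X.obj m ⟶ R.X.obj m} (hg : IsComponent f n g) (hg' : IsComponent f m g') :
    S.obj.j h ≫ g' = g ≫ R.j h := by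
  obtain h | rfl := h.lt_or_eq
  · obtain ⟨g₁, hg₁, hn, -⟩ := hg'.spec.2 n h
    rw [hn, hS.isComponent_unique hg₁ hg]
  · simp [hS.isComponent_unique hg hg']

lemma isComponent_x {n : Ordinal.{w}} {g : S.obj.X.obj n ⟶ R.X.obj n}
    {g' : S.obj.X.obj (n + 1) ⟶ R.X.obj (n + 1)} (hg : IsComponent f n g)
    (hg' : IsComponent f (n + 1) g') : S.obj.x n ≫ g' = T.map g ≫ R.x n := by
  obtain ⟨g₁, hg₁, -, hx⟩ := hg'.spec.2 n (lt_add_one n)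
  rw [hS.isComponent_unique hg₁ hg] at hx
  simpa using hx

omit hS in
lemma isComponent_succ {n : Ordinal.{w}} {g : S.obj.X.obj n ⟶ R.X.obj n}
    {g' : S.obj.X.obj (n + 1) ⟶ R.X.obj (n + 1)} (hg : IsComponent f n g)
    (hx : S.obj.x n ≫ g' = T.map g ≫ R.x n) : IsComponent f (n + 1) g' := by
  have hj : S.obj.j le_self_add ≫ g' = g ≫ R.j (le_self_add : n ≤ n + 1) := by
    rw [← unit_x, Category.assoc, hx, ← unit_x]
    exact (η.naturality_assoc g _).symm
  refine .of_spec ?_ fun k hk ↦ ?_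
  · rw [← j_comp _ zero_le le_self_add, Category.assoc, hj, reassoc_of% hg.spec.1, j_comp]
  · obtain hk' | rfl := (Order.lt_add_one_iff.1 hk).lt_or_eq
    · obtain ⟨g₁, hg₁, hn₁, hx₁⟩ := hg.spec.2 k hk'
      refine ⟨g₁, hg₁, ?_, ?_⟩
      · rw [← j_comp _ hk'.le le_self_add, Category.assoc, hj, reassoc_of% hn₁, j_comp]
      · rw [← j_comp _ (Order.add_one_le_of_lt hk') le_self_add, Category.assoc, hj,
          reassoc_of% hx₁, j_comp]
    · exact ⟨g, hg, hj, by simpa using hx⟩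

lemma exists_isComponent (hR : IsSpecialChain.{w} η γ lam R) (f : S.obj.X.obj 0 ⟶ R.X.obj 0)
    (n : Ordinal.{w}) : ∃ g, IsComponent f n g := by
  induction n using Ordinal.limitRecOn with
  | zero => exact ⟨f, .of_spec (by simp) fun _ hk ↦ absurd hk not_lt_zero⟩
  | add_one n ih =>
    obtain ⟨g, hg⟩ := ih
    suffices h : ∃ g', S.obj.x n ≫ g' = T.map g ≫ R.x n from
      h.imp fun g' hg' ↦ isComponent_succ hg hg'
    rcases eq_zero_or_add_one_or_isSuccLimit n with rfl | ⟨k, rfl⟩ | hn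
    · have := hS.first
      exact ⟨inv (S.obj.x 0) ≫ T.map g ≫ R.x 0, by simp⟩
    · obtain ⟨g₁, hg₁, hn₁, hx₁⟩ := hg.spec.2 k (lt_add_one k)
      simp only [j_self, Category.comp_id, Category.id_comp] at hx₁
      refine ((hS.step k).2 (T.map g ≫ R.x (k + 1)) ?_ ?_).exists
      -- The first pair is equalised by naturality of `η`, the unit law and compatibility of `R.x`
      -- with connecting maps.
      · have h₁ := η.naturality g₁
        have h₂ := η.naturality (R.x k)
        simp only [Functor.id_map, Functor.id_obj] at h₁ h₂
        have h₃ := η.naturality (T.map g₁)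
        simp only [Functor.id_map, Functor.id_obj] at h₃
        simp only [Category.assoc, ← T.map_comp_assoc, hx₁]
        rw [← reassoc_of% h₁, unit_x, T.map_comp_assoc, map_j_x]
        rw [T.map_comp_assoc, ← reassoc_of% h₃, ← reassoc_of% h₂, unit_x]
      -- For the second pair the special condition on `R` is needed, at `k`.
      · have h₁ := γ.naturality g₁
        have h₂ := lam.naturality g₁
        simp only [Functor.comp_map, Functor.comp_obj] at h₂
        have h₃ := hR k
        simp only [Category.assoc, ← T.map_comp_assoc, hx₁, hn₁]
        rw [T.map_comp_assoc, ← reassoc_of% h₂, ← h₃, T.map_comp_assoc, map_j_x,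
          ← reassoc_of% h₁]
    · refine ((hS.limit_step n hn).2 (T.map g ≫ R.x n) fun k ↦ ?_).exists
      obtain ⟨g₁, hg₁, hn₁, hx₁⟩ := hg.spec.2 k.1 k.2
      have h₁ := η.naturality g
      simp only [Functor.id_map, Functor.id_obj] at h₁
      simp only [Category.assoc]
      rw [← reassoc_of% h₁, unit_x, ← T.map_comp_assoc, hn₁, T.map_comp_assoc, map_j_x,
        reassoc_of% hx₁, j_comp]
  | limit n hn ih =>
    choose g hg using ih
    have := hS.limit
    obtain ⟨u, hu⟩ := S.obj.exists_desc_of_isSuccLimit hn (fun k hk ↦ g k hk ≫ R.j hk.le)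
      fun {k k'} h hk' ↦ by
        rw [reassoc_of% hS.isComponent_nat h (hg k _) (hg k' hk'), j_comp]
    refine ⟨u, .of_spec ?_ fun k hk ↦ ⟨g k hk, hg k hk, hu k hk, ?_⟩⟩
    · have h₀ : g 0 hn.bot_lt = f := by simpa using (hg 0 hn.bot_lt).spec.1
      rw [hu 0 hn.bot_lt, h₀]
    · rw [hu (k + 1) (hn.add_one_lt hk), reassoc_of% hS.isComponent_x (hg k hk) (hg _ _)]

omit hS in
lemma component_isComponent (a : S.obj ⟶ R) (n : Ordinal.{w}) :
    IsComponent (a.f.app 0) n (a.f.app n) := by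
  induction n using WellFoundedLT.induction with
  | ind n ih =>
    refine .of_spec (a.j_app _) fun k hk ↦ ⟨a.f.app k, ih k hk, a.j_app _, ?_⟩
    rw [a.j_app, ← reassoc_of% a.comm]

/-- Two morphisms out of the chain `X⋆` are equal when their components at `0` are. -/
lemma hom_ext {a b : S.obj ⟶ R} (h : a.f.app 0 = b.f.app 0) : a = b := by
  refine AlgebraicChain.Hom.ext (NatTrans.ext (funext fun n ↦ ?_))
  exact hS.isComponent_unique (f := b.f.app 0) (h ▸ component_isComponent a n)
    (component_isComponent b n)

/-- A morphism out of the chain `X⋆` into a special chain is determined by its value at `0`. -/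
lemma exists_hom (hR : IsSpecialChain.{w} η γ lam R) (f : S.obj.X.obj 0 ⟶ R.X.obj 0) :
    ∃ a : S.obj ⟶ R, a.f.app 0 = f := by
  choose g hg using hS.exists_isComponent hR f
  refine ⟨{ f := { app := g, naturality := fun n m h ↦ ?_ }, comm := fun n ↦ ?_ }, ?_⟩
  · exact hS.isComponent_nat (leOfHom h) (hg n) (hg m)
  · exact (hS.isComponent_x (hg n) (hg _)).symm
  · simpa using (hg 0).spec.1

/-- The chain `X⋆` is the free special algebraic chain on `X`. -/
theorem isFreeOn_forget : IsFreeOn (SpecialChain.forget.{w} η γ lam) X S i.hom := by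
  intro R f
  obtain ⟨a, ha⟩ := hS.exists_hom R.property (i.inv ≫ f)
  refine ⟨ObjectProperty.homMk a, ?_, fun b hb ↦ ?_⟩
  · exact (congr_arg (i.hom ≫ ·) ha).trans (i.hom_inv_id_assoc f)
  · refine ObjectProperty.hom_ext _ (hS.hom_ext ?_)
    rw [← cancel_epi i.hom]
    exact hb.trans ((congr_arg (i.hom ≫ ·) ha).trans (i.hom_inv_id_assoc f)).symm

end IsStarChain

end Free

/-! ### Special algebras and stabilisation -/

section Stabilisation

variable {C : Type u} [Category.{v} C] {T T₂ : C ⥤ C}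
  {η : 𝟭 C ⟶ T} {γ : T₂ ⟶ T} {lam : T₂ ⟶ T ⋙ T}

open AlgebraicChain

/-- The structure map of `AlgebraicChain.pointAlgebra`. -/
noncomputable def AlgebraicChain.pointStr (S : AlgebraicChain.{w} η) {n : Ordinal.{w}}
    (hn : S.StabilisesAt n) : T.obj (S.X.obj n) ⟶ S.X.obj n :=
  (S.pointAlgebra n hn).str

lemma AlgebraicChain.pointStr_j (S : AlgebraicChain.{w} η) {n : Ordinal.{w}}
    (hn : S.StabilisesAt n) : S.pointStr hn ≫ S.j (le_self_add : n ≤ n + 1) = S.x n := by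
  have : IsIso (S.j (le_self_add : n ≤ n + 1)) := hn (n + 1) (lt_add_one n)
  simp [pointStr, pointAlgebra]

/-- The constant chain on an algebra for a pointed endofunctor. -/
def constChain (η : 𝟭 C ⟶ T) (A : Endofunctor.Algebra T) (hA : η.app A.a ≫ A.str = 𝟙 A.a) :
    AlgebraicChain.{w} η where
  X := (Functor.const _).obj A.a
  x _ := A.str
  unit _ := hA
  compat _ := by simp

lemma isSpecialChain_constChain {A : Endofunctor.Algebra T} (hA : IsSpecialAlgebra η γ lam A) :
    IsSpecialChain.{w} η γ lam (constChain η A hA.1) := fun _ ↦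
  (congr_arg (γ.app A.a ≫ ·) (Category.comp_id A.str)).trans hA.2

namespace IsStarChain

variable {X : C} {S : SpecialChain.{w} η γ lam} {i : X ≅ S.obj.X.obj 0} (hS : IsStarChain X S i)

include hS

/-- The components of the morphism to a constant chain induced by a morphism to an algebra. -/
lemma exists_components {A : Endofunctor.Algebra T} (hA : IsSpecialAlgebra η γ lam A)
    (f : S.obj.X.obj 0 ⟶ A.a) :
    ∃ a : ∀ n, S.obj.X.obj n ⟶ A.a, a 0 = f ∧ (∀ {n m} (h : n ≤ m), S.obj.j h ≫ a m = a n) ∧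
      ∀ n, S.obj.x n ≫ a (n + 1) = T.map (a n) ≫ A.str := by
  obtain ⟨a, ha⟩ := hS.exists_hom (isSpecialChain_constChain hA) f
  exact ⟨fun n ↦ a.f.app n, ha, fun h ↦ (a.f.naturality _).trans (Category.comp_id _),
    fun n ↦ (a.comm n).symm⟩

/-- This gives uniqueness for the free algebra: agreement of algebra maps at 0 propagates up the
chain, since `β` restricts to the epimorphisms `x` below `n`. -/
lemma j_comp_eq_of_algebra {n : Ordinal.{w}} {β : T.obj (S.obj.X.obj n) ⟶ S.obj.X.obj n}
    (hβ : ∀ (k) (hk : k < n), T.map (S.obj.j hk.le) ≫ β =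
      S.obj.x k ≫ S.obj.j (Order.add_one_le_of_lt hk))
    {A : C} {str : T.obj A ⟶ A} {g g' : S.obj.X.obj n ⟶ A} (hg : T.map g ≫ str = β ≫ g)
    (hg' : T.map g' ≫ str = β ≫ g')
    (h₀ : S.obj.j (zero_le (a := n)) ≫ g = S.obj.j (zero_le (a := n)) ≫ g') : g = g' := by
  suffices h : ∀ (m) (hm : m ≤ n), S.obj.j hm ≫ g = S.obj.j hm ≫ g' by simpa using h n le_rfl
  intro m
  induction m using Ordinal.limitRecOn with
  | zero => exact fun _ ↦ h₀
  | add_one m ih =>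
    intro hm
    have hm' := Order.add_one_le_iff.1 hm
    have := hS.epi_x m
    rw [← cancel_epi (S.obj.x m), ← reassoc_of% hβ m hm', ← reassoc_of% hβ m hm', ← hg, ← hg',
      ← T.map_comp_assoc, ← T.map_comp_assoc, ih hm'.le]
  | limit m hm ih =>
    intro hmn
    have := hS.limit
    refine S.obj.epi_family_of_isSuccLimit hm fun k hk ↦ ?_
    rw [j_comp_assoc, j_comp_assoc, ih k hk]

omit hS in
lemma isIso_j {n m k : Ordinal.{w}} (hn : S.obj.StabilisesAt n) (h : n ≤ m) (h' : m ≤ k) :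
    IsIso (S.obj.j h') := by
  have key (l) (hl : n ≤ l) : IsIso (S.obj.j hl) := by
    obtain hl | rfl := hl.lt_or_eq
    · exact hn l hl
    · rw [j_self]; infer_instance
  have := key m h
  have := key k (h.trans h')
  have e := S.obj.j_comp h h'
  exact IsIso.of_isIso_fac_left e

omit hS in
lemma map_j_pointStr {n : Ordinal.{w}} (hn : S.obj.StabilisesAt n) {k : Ordinal.{w}}
    (hk : k < n) : T.map (S.obj.j hk.le) ≫ S.obj.pointStr hn =
      S.obj.x k ≫ S.obj.j (Order.add_one_le_of_lt hk) := by
  have : IsIso (S.obj.j (le_self_add : n ≤ n + 1)) := hn (n + 1) (lt_add_one n)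
  rw [← cancel_mono (S.obj.j (le_self_add : n ≤ n + 1)), Category.assoc, Category.assoc,
    pointStr_j, map_j_x, j_comp]

omit hS in
lemma isSpecialAlgebra_pointAlgebra {n : Ordinal.{w}} (hn : S.obj.StabilisesAt n) :
    IsSpecialAlgebra η γ lam (S.obj.pointAlgebra n hn) := by
  have h₁ : IsIso (S.obj.j (le_self_add : n ≤ n + 1)) := hn (n + 1) (lt_add_one n)
  have h₂ : IsIso (S.obj.j (le_self_add : n + 1 ≤ n + 1 + 1)) := isIso_j hn le_self_add _
  have hβ := S.obj.pointStr_j hn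
  change η.app (S.obj.X.obj n) ≫ S.obj.pointStr hn = 𝟙 _ ∧ γ.app (S.obj.X.obj n) ≫
    S.obj.pointStr hn = lam.app (S.obj.X.obj n) ≫ T.map (S.obj.pointStr hn) ≫ S.obj.pointStr hn
  constructor
  · rw [← cancel_mono (S.obj.j (le_self_add : n ≤ n + 1)), Category.assoc, hβ, unit_x,
      Category.id_comp]
  · rw [← cancel_mono (S.obj.j (le_self_add : n ≤ n + 1)),
      ← cancel_mono (S.obj.j (le_self_add : n + 1 ≤ n + 1 + 1))]
    simp only [Category.assoc]
    rw [reassoc_of% hβ, S.property n, ← hβ, T.map_comp_assoc, map_j_x, ← hβ, Category.assoc]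

/-- At an ordinal where the chain `X⋆` stabilises, it is the free special algebra on `X`. -/
theorem isFreeOn_pointAlgebra {n : Ordinal.{w}} (hn : S.obj.StabilisesAt n) :
    IsFreeOn (SpecialAlgebra.forget η γ lam) X
      ⟨S.obj.pointAlgebra n hn, isSpecialAlgebra_pointAlgebra hn⟩
      (i.hom ≫ S.obj.j (zero_le (a := n))) := by
  intro A f
  change X ⟶ A.obj.a at f
  have : IsIso (S.obj.j (le_self_add : n ≤ n + 1)) := hn (n + 1) (lt_add_one n)
  obtain ⟨a, ha₀, haj, hax⟩ := hS.exists_components A.property (i.inv ≫ f)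
  let g : S.obj.pointAlgebra n hn ⟶ A.obj :=
    { f := a n
      h := by
        have h := hax n
        rw [← S.obj.pointStr_j hn, Category.assoc, haj] at h
        exact h.symm }
  have hg : (i.hom ≫ S.obj.j (zero_le (a := n))) ≫ a n = f := by
    rw [Category.assoc, haj, ha₀, Iso.hom_inv_id_assoc]
  refine ⟨ObjectProperty.homMk g, hg, fun b hb ↦ ?_⟩
  refine ObjectProperty.hom_ext _ (Endofunctor.Algebra.Hom.ext ?_)
  refine hS.j_comp_eq_of_algebra (β := S.obj.pointStr hn)
    (fun k hk ↦ map_j_pointStr hn hk) b.hom.h g.h ?_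
  refine (cancel_epi i.hom).1 ?_
  exact (Category.assoc _ _ _).symm.trans ((hb.trans hg.symm).trans (Category.assoc _ _ _))

/-- The chain `X⋆` stabilises at `α` as soon as `x_α` is, up to the connecting map, the structure
map of a special algebra compatible with the previous structure maps. -/
lemma stabilisesAt_of_algebra {α : Ordinal.{w}} {β : T.obj (S.obj.X.obj α) ⟶ S.obj.X.obj α}
    (hβ : ∀ (k) (hk : k < α), T.map (S.obj.j hk.le) ≫ β =
      S.obj.x k ≫ S.obj.j (Order.add_one_le_of_lt hk))
    (hβ' : IsSpecialAlgebra η γ lam ⟨S.obj.X.obj α, β⟩)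
    (hx : β ≫ S.obj.j le_self_add = S.obj.x α) : S.obj.StabilisesAt α := by
  have := hS.limit
  obtain ⟨a, ha₀, haj, hax⟩ := hS.exists_components hβ' (S.obj.j zero_le)
  change ∀ n, S.obj.X.obj n ⟶ S.obj.X.obj α at a
  have ha : ∀ (m) (hm : m ≤ α), a m = S.obj.j hm := by
    intro m
    induction m using Ordinal.limitRecOn with
    | zero => exact fun _ ↦ ha₀
    | add_one m ih =>
      intro hm
      have hm' := Order.add_one_le_iff.1 hm
      have := hS.epi_x m
      rw [← cancel_epi (S.obj.x m), ← hβ m hm', ← ih hm'.le]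
      exact hax m
    | limit m hm ih =>
      intro hmn
      refine S.obj.epi_family_of_isSuccLimit hm fun k hk ↦ ?_
      rw [j_comp, ← ih k hk (hk.le.trans hmn)]
      exact haj hk.le
  -- The other composite is `a α`, an identity by `ha`. In the successor step here, `hx` replaces
  -- `β` by x_α, after which the inductive hypothesis can be used inside `T`.
  have ha' : ∀ (m) (hm : α ≤ m), a m ≫ S.obj.j hm = 𝟙 _ := by
    intro m
    induction m using WellFoundedLT.induction with
    | ind m ih =>
      intro hm
      obtain hm | rfl := hm.lt_or_eq; swap
      · rw [ha α le_rfl, j_comp, j_self]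
      rcases eq_zero_or_add_one_or_isSuccLimit m with rfl | ⟨m, rfl⟩ | hml
      · exact absurd hm not_lt_zero
      · have hm' := Order.lt_add_one_iff.1 hm
        have := hS.epi_x m
        have h₁ : S.obj.x m ≫ a (m + 1) = T.map (a m) ≫ β := hax m
        rw [← cancel_epi (S.obj.x m), reassoc_of% h₁,
          ← S.obj.j_comp (le_self_add : α ≤ α + 1) (add_le_add_left hm' 1), reassoc_of% hx,
          ← S.obj.map_j_x hm', ← T.map_comp_assoc, ih m (lt_add_one m) hm']
        simp
      · refine S.obj.epi_family_of_isSuccLimit hml fun k hk ↦ ?_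
        have h₁ : S.obj.j hk.le ≫ a m = a k := haj hk.le
        rw [reassoc_of% h₁, Category.comp_id]
        obtain h | h := le_total α k
        · rw [← S.obj.j_comp h hk.le, reassoc_of% ih k hk h]
        · rw [ha k h, j_comp]
  intro m hm
  have h₁ : S.obj.j hm.le ≫ a m = a α := haj hm.le
  exact ⟨a m, by rw [h₁, ha α le_rfl, j_self], ha' m hm.le⟩

/-- The chain `X⋆` stabilises at a limit ordinal if both functors preserve the colimit there. -/
theorem stabilisesAt_of_preservesColimit {α : Ordinal.{w}} (hα : Order.IsSuccLimit α)
    [PreservesColimit ((Set.principalSegIio α).monotone.functor ⋙ S.obj.X) T]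
    [PreservesColimit ((Set.principalSegIio α).monotone.functor ⋙ S.obj.X) T₂] :
    S.obj.StabilisesAt α := by
  have := hS.limit
  have hc := S.obj.X.isColimitOfIsWellOrderContinuous α hα
  have ext {U : C ⥤ C} [PreservesColimit ((Set.principalSegIio α).monotone.functor ⋙ S.obj.X) U]
      {Z : C} {u v : U.obj (S.obj.X.obj α) ⟶ Z}
      (h : ∀ (k) (hk : k < α), U.map (S.obj.j hk.le) ≫ u = U.map (S.obj.j hk.le) ≫ v) : u = v :=
    (isColimitOfPreserves U hc).hom_ext fun k ↦ h k.1 k.2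
  let c : Cocone (((Set.principalSegIio α).monotone.functor ⋙ S.obj.X) ⋙ T) :=
    { pt := S.obj.X.obj α
      ι := { app n := S.obj.x n.1 ≫ S.obj.j (Order.add_one_le_of_lt n.2)
             naturality n n' f := by
              refine Eq.trans ?_ (Category.comp_id _).symm
              refine (S.obj.map_j_x_assoc (leOfHom f) _).trans ?_
              exact congr_arg _ (S.obj.j_comp _ _) } }
  obtain ⟨β, hβ⟩ : ∃ β : T.obj (S.obj.X.obj α) ⟶ S.obj.X.obj α,
      ∀ (k) (hk : k < α), T.map (S.obj.j hk.le) ≫ β =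
        S.obj.x k ≫ S.obj.j (Order.add_one_le_of_lt hk) :=
    ⟨(isColimitOfPreserves T hc).desc c,
      fun k hk ↦ (isColimitOfPreserves T hc).fac c ⟨k, hk⟩⟩
  -- The special law is tested on T₂ X_α and the comparison with x_α on T X_α; each is checked on
  -- the images of earlier stages, as both functors preserve the colimit.
  refine hS.stabilisesAt_of_algebra hβ ⟨?_, ext fun k hk ↦ ?_⟩ (ext fun k hk ↦ ?_)
  · refine S.obj.epi_family_of_isSuccLimit hα fun k hk ↦ ?_
    have h := η.naturality (S.obj.j hk.le)
    simp only [Functor.id_map, Functor.id_obj] at h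
    dsimp only
    rw [reassoc_of% h, hβ k hk, unit_x_assoc, j_comp, Category.comp_id]
  · have h₁ := γ.naturality (S.obj.j hk.le)
    have h₂ := lam.naturality (S.obj.j hk.le)
    simp only [Functor.comp_map, Functor.comp_obj] at h₂
    have hk' := hα.add_one_lt hk
    have h₃ := S.property k
    dsimp only
    rw [reassoc_of% h₁, reassoc_of% h₂, hβ k hk, ← T.map_comp_assoc, hβ k hk, T.map_comp_assoc, hβ _ hk',
      ← reassoc_of% h₃, j_comp]
  · rw [reassoc_of% hβ k hk, map_j_x, j_comp]

end IsStarChain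

end Stabilisation

/-! ### Preservation of colimits under interleaving and finality -/

section Interleaving

variable {C : Type*} [Category* C] {D : Type*} [Category* D]

/-- Two diagrams which are interleaved through epimorphisms have the same colimit, and the same
functors preserve it. -/
lemma preservesColimit_of_interleaving {J : Type*} [Preorder J] [IsDirectedOrder J] {F Z : J ⥤ C}
    (e : F ⟶ Z) [∀ i, Epi (e.app i)]
    (he : ∀ i, ∃ (i' : J) (h : i ≤ i') (m : Z.obj i ⟶ F.obj i'),
      e.app i ≫ m = F.map (homOfLE h)) (G : C ⥤ D) [PreservesColimit Z G] :
    PreservesColimit F G := by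
  choose σ hσ m hm using he
  have hme (i : J) : m i ≫ e.app (σ i) = Z.map (homOfLE (hσ i)) := by
    rw [← cancel_epi (e.app i), reassoc_of% hm, e.naturality]
  have hmm {i k l : J} (h : i ≤ k) (hi : σ i ≤ l) (hk : σ k ≤ l) :
      Z.map (homOfLE h) ≫ m k ≫ F.map (homOfLE hk) = m i ≫ F.map (homOfLE hi) := by
    rw [← cancel_epi (e.app i), ← e.naturality_assoc, reassoc_of% hm, reassoc_of% hm,
      ← F.map_comp, ← F.map_comp, ← F.map_comp]
    rfl
  refine ⟨fun {c'} hc' ↦ ?_⟩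
  have hw {i k : J} (h : i ≤ k) :
      Z.map (homOfLE h) ≫ m k ≫ c'.ι.app (σ k) = m i ≫ c'.ι.app (σ i) := by
    obtain ⟨l, hi, hk⟩ := exists_ge_ge (σ i) (σ k)
    rw [← c'.w (homOfLE hi), ← c'.w (homOfLE hk), reassoc_of% hmm h hi hk]
  let c : Cocone Z :=
    { pt := c'.pt
      ι := { app i := m i ≫ c'.ι.app (σ i)
             naturality _ _ f := (hw (leOfHom f)).trans (Category.comp_id _).symm } }
  have hec (i : J) : e.app i ≫ c.ι.app i = c'.ι.app i := by
    dsimp only [c]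
    rw [reassoc_of% hm, c'.w]
  have hc : IsColimit c :=
    { desc s := hc'.desc ((Cocone.precompose e).obj s)
      fac s i := by
        dsimp only [c]
        rw [Category.assoc, hc'.fac]
        exact ((Category.assoc _ _ _).symm.trans (congr_arg (· ≫ _) (hme i))).trans (s.w _)
      uniq s d hd := hc'.hom_ext fun i ↦ by
        rw [hc'.fac, ← hec, Category.assoc, hd]
        rfl }
  have hGc := isColimitOfPreserves G hc
  have hGw (s : Cocone (F ⋙ G)) {i k : J} (h : i ≤ k) :
      G.map (Z.map (homOfLE h)) ≫ G.map (m k) ≫ s.ι.app (σ k) = G.map (m i) ≫ s.ι.app (σ i) := by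
    obtain ⟨l, hi, hk⟩ := exists_ge_ge (σ i) (σ k)
    have h₁ : G.map (F.map (homOfLE hi)) ≫ s.ι.app l = s.ι.app (σ i) := s.w (homOfLE hi)
    have h₂ : G.map (F.map (homOfLE hk)) ≫ s.ι.app l = s.ι.app (σ k) := s.w (homOfLE hk)
    rw [← h₁, ← h₂, ← G.map_comp_assoc, ← G.map_comp_assoc, ← G.map_comp_assoc, Category.assoc,
      hmm h hi hk]
  let t (s : Cocone (F ⋙ G)) : Cocone (Z ⋙ G) :=
    { pt := s.pt
      ι := { app i := G.map (m i) ≫ s.ι.app (σ i)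
             naturality _ _ f := (hGw s (leOfHom f)).trans (Category.comp_id _).symm } }
  have hfac (s : Cocone (F ⋙ G)) (i : J) : G.map (c.ι.app i) ≫ hGc.desc (t s) =
      G.map (m i) ≫ s.ι.app (σ i) := hGc.fac (t s) i
  refine ⟨{ desc s := hGc.desc (t s), fac s i := ?_, uniq s d hd := ?_ }⟩
  · change G.map (c'.ι.app i) ≫ hGc.desc (t s) = s.ι.app i
    rw [← hec, G.map_comp, Category.assoc, hfac, ← G.map_comp_assoc, hm]
    exact s.w _
  · refine hGc.hom_ext fun i ↦ ?_
    rw [hGc.fac]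
    change G.map (m i ≫ c'.ι.app (σ i)) ≫ d = G.map (m i) ≫ s.ι.app (σ i)
    rw [G.map_comp, Category.assoc]
    exact congr_arg _ (hd (σ i))

lemma preservesColimit_of_final {J K : Type*} [Category* J] [Category* K] (φ : J ⥤ K) [φ.Final]
    (F : K ⥤ C) (G : C ⥤ D) [PreservesColimit (φ ⋙ F) G] : PreservesColimit F G :=
  ⟨fun {c} hc ↦ ⟨Functor.Final.isColimitWhiskerEquiv φ (G.mapCocone c)
    (isColimitOfPreserves G ((Functor.Final.isColimitWhiskerEquiv φ c).symm hc))⟩⟩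

end Interleaving

/-! ### Eventually constant images -/

section FactorisationSystem

variable {C : Type u} [Category.{v} C] {E M : MorphismProperty C}
  (hEM : IsFactorisationSystem E M) (hp : IsProper E M)

-- The `E`-part of `f` acquires a retraction from the diagonal filler, and being epi it is
-- invertible.
include hEM hp in
lemma IsFactorisationSystem.of_comp {A B B' : C} {f : A ⟶ B} {g : B ⟶ B'} (h : M (f ≫ g)) :
    M f := by
  obtain ⟨I, e, m, he, hm, rfl⟩ := hEM.factorisation f
  obtain ⟨d, ⟨hd, -⟩, -⟩ := hEM.diagonal e ((e ≫ m) ≫ g) (𝟙 A) (m ≫ g) he h (by simp)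
  have := hp.epi e he
  have : IsIso e := ⟨d, hd, by rw [← cancel_epi e, reassoc_of% hd, Category.comp_id]⟩
  have := hEM.respectsIso_right
  exact (MorphismProperty.cancel_left_of_respectsIso M e m).2 hm

include hEM hp in
/-- In a chain, the image of `X_n ⟶ X_k` is eventually independent of `k`. -/
lemma exists_stable_image (hE : IsCoWellPowered.{w} E) (X : Ordinal.{w} ⥤ C) (n : Ordinal.{w}) :
    ∃ (k : Ordinal.{w}) (hk : n < k) (Z : C) (e : X.obj n ⟶ Z) (m : Z ⟶ X.obj k),
      E e ∧ e ≫ m = X.map (homOfLE hk.le) ∧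
      ∀ (l : Ordinal.{w}) (h : k ≤ l), M (m ≫ X.map (homOfLE h)) := by
  obtain ⟨ι, Q, q, hQ⟩ := hE (X.obj n)
  choose I e m he hm hem using fun (l : Ordinal.{w}) (h : n ≤ l) ↦
    hEM.factorisation (X.map (homOfLE h))
  choose r s hs using fun (l : Ordinal.{w}) (h : n ≤ l) ↦ hQ _ _ (he l h)
  -- Pigeonhole: if each of the small set of quotients occurred only boundedly often, the supremum
  -- of the bounds would leave no quotient for later images.
  obtain ⟨i, hi⟩ : ∃ i, ∀ l, ∃ (l' : Ordinal.{w}) (h : n ≤ l'), l ≤ l' ∧ r l' h = i := by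
    by_contra! hcon
    choose b hb using hcon
    exact hb _ _ le_sup_left ((Ordinal.le_iSup b _).trans le_sup_right) rfl
  obtain ⟨k, hnk, hk, hki⟩ := hi (n + 1)
  have := hEM.respectsIso_right
  refine ⟨k, Order.add_one_le_iff.1 hk, I k hnk, e k hnk, m k hnk, he _ _, hem _ _, fun l hl ↦ ?_⟩
  have hnl := hnk.trans hl
  obtain ⟨l', hnl', hl', hli⟩ := hi l
  obtain ⟨t, ⟨ht, htm⟩, -⟩ := hEM.diagonal (e k hnk) (m l hnl) (e l hnl)
    (m k hnk ≫ X.map (homOfLE hl)) (he _ _) (hm _ _) (by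
      rw [hem, reassoc_of% hem, ← X.map_comp, homOfLE_comp])
  obtain ⟨t', ⟨ht', -⟩, -⟩ := hEM.diagonal (e l hnl) (m l' hnl') (e l' hnl')
    (m l hnl ≫ X.map (homOfLE hl')) (he _ _) (hm _ _) (by
      rw [hem, reassoc_of% hem, ← X.map_comp, homOfLE_comp])
  have hek := hp.epi _ (he k hnk)
  have hel := hp.epi _ (he l hnl)
  have hQQ {a b : ι} (h : a = b) {U V : C} (f : Q a ≅ U) (g : Q b ≅ V) :
      ∃ u : U ⟶ V, (q a ≫ f.hom) ≫ u = q b ≫ g.hom := by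
    subst h
    exact ⟨f.inv ≫ g.hom, by simp⟩
  obtain ⟨u, hu⟩ := hQQ (hli.trans hki.symm) (s l' hnl') (s k hnk)
  rw [hs, hs] at hu
  -- The image at `l` lies between those at `k` and `l'`, which are the same quotient of X_n; hence
  -- `t` is invertible.
  have : IsIso t := ⟨t' ≫ u, by
    rw [← cancel_epi (e k hnk), reassoc_of% ht, reassoc_of% ht', hu, Category.comp_id], by
    rw [← cancel_epi (e l hnl), Category.assoc, reassoc_of% ht', reassoc_of% hu, ht,
      Category.comp_id]⟩
  rw [← htm]
  exact (MorphismProperty.cancel_left_of_respectsIso M t _).2 (hm _ _)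

end FactorisationSystem

/-! ### From M-chains to a preserved stage of X⋆ -/

section MChains

/-- A sequence of ordinals growing at least as fast as `κ`. -/
noncomputable def iterSup (κ : Ordinal.{w} → Ordinal.{w}) (i : Ordinal.{w}) : Ordinal.{w} :=
  ⨆ j : Set.Iio i, κ (iterSup κ j.1)
termination_by i
decreasing_by exact j.2

lemma apply_iterSup_le (κ : Ordinal.{w} → Ordinal.{w}) {i i' : Ordinal.{w}} (h : i < i') :
    κ (iterSup κ i) ≤ iterSup κ i' := by
  rw [iterSup.eq_1 κ i']
  exact le_ciSup (f := fun j : Set.Iio i' ↦ κ (iterSup κ j.1)) (Ordinal.bddAbove_of_small) ⟨i, h⟩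

lemma iterSup_strictMono {κ : Ordinal.{w} → Ordinal.{w}} (hκ : ∀ n, n < κ n) :
    StrictMono (iterSup κ) :=
  fun _ _ h ↦ (hκ _).trans_le (apply_iterSup_le κ h)

lemma iterSup_lt_iff {κ : Ordinal.{w} → Ordinal.{w}} (hκ : ∀ n, n < κ n) {α : Ordinal.{w}}
    (hα : Order.IsSuccLimit α) {n : Ordinal.{w}} :
    n < iterSup κ α ↔ ∃ i < α, n < iterSup κ i := by
  refine ⟨fun h ↦ ?_, fun ⟨i, hi, h⟩ ↦ h.trans (iterSup_strictMono hκ hi)⟩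
  rw [iterSup.eq_1 κ α] at h
  by_contra! hcon
  refine absurd h (not_lt.2 (Ordinal.iSup_le fun j ↦ ?_))
  exact (apply_iterSup_le κ (lt_add_one j.1)).trans (hcon _ (hα.add_one_lt j.2))

lemma isSuccLimit_iterSup {κ : Ordinal.{w} → Ordinal.{w}} (hκ : ∀ n, n < κ n) {α : Ordinal.{w}}
    (hα : Order.IsSuccLimit α) : Order.IsSuccLimit (iterSup κ α) := by
  rw [Ordinal.isSuccLimit_iff, Order.isSuccPrelimit_iff_succ_lt]
  refine ⟨((zero_le).trans_lt (iterSup_strictMono hκ hα.bot_lt)).ne', fun n hn ↦ ?_⟩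
  obtain ⟨i, hi, hni⟩ := (iterSup_lt_iff hκ hα).1 hn
  exact (Order.succ_le_of_lt hni).trans_lt (iterSup_strictMono hκ hi)

variable {C : Type u} [Category.{v} C] {E M : MorphismProperty C}

/-- Given a proper co-well-powered factorisation system, every chain has arbitrarily long limit
stages whose colimit is preserved by all functors preserving colimits of `(α, M)`-chains. -/
lemma exists_preservesColimit (hEM : IsFactorisationSystem E M) (hp : IsProper E M)
    (hE : IsCoWellPowered.{w} E) {α : Ordinal.{w}} (hα : Order.IsSuccLimit α)
    (X : Ordinal.{w} ⥤ C) :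
    ∃ β : Ordinal.{w}, Order.IsSuccLimit β ∧ ∀ U : C ⥤ C, PreservesMChains α M U →
      PreservesColimit ((Set.principalSegIio β).monotone.functor ⋙ X) U := by
  choose κ hκ Z e m he hem hm using exists_stable_image hEM hp hE X
  have hmono := iterSup_strictMono hκ
  have hepi (n) : Epi (e n) := hp.epi _ (he n)
  let b : Set.Iio α → Set.Iio (iterSup κ α) := fun i ↦ ⟨iterSup κ i.1, hmono i.2⟩
  have hb : Monotone b := fun _ _ h ↦ hmono.monotone h
  -- The ordinals `iterSup κ i` are cofinal in their supremum, so preservation need only be checked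
  -- along them.
  have hfinal : hb.functor.Final := by
    have : Nonempty (Set.Iio α) := ⟨⟨⊥, hα.bot_lt⟩⟩
    rw [Monotone.final_functor_iff]
    intro n
    obtain ⟨i, hi, hn⟩ := (iterSup_lt_iff hκ hα).1 n.2
    exact ⟨⟨i, hi⟩, hn.le⟩
  have hd (i i' : Set.Iio α) (h : i ≤ i') : ∃ d : Z (iterSup κ i) ⟶ Z (iterSup κ i'),
      e _ ≫ d = X.map (homOfLE (hmono.monotone h)) ≫ e _ := by
    obtain h' | rfl := h.lt_or_eq
    · refine ⟨m _ ≫ X.map (homOfLE (apply_iterSup_le κ h')) ≫ e _, ?_⟩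
      rw [reassoc_of% hem, ← X.map_comp_assoc, homOfLE_comp]
    · exact ⟨𝟙 _, by simp⟩
  choose d hd using hd
  let W : Set.Iio α ⥤ C :=
    { obj i := Z (iterSup κ i.1)
      map f := d _ _ (leOfHom f)
      map_id i := by
        rw [← cancel_epi (e _), hd]
        simp
      map_comp f g := by
        rw [← cancel_epi (e _), hd, reassoc_of% hd, hd, ← X.map_comp_assoc, homOfLE_comp] }
  have hW {i i' : Set.Iio α} (f : i ⟶ i') : M (W.map f) := by
    have h₁ : κ (iterSup κ i.1) ≤ max (κ (iterSup κ i.1)) (κ (iterSup κ i'.1)) := le_max_left _ _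
    have h₂ : κ (iterSup κ i'.1) ≤ max (κ (iterSup κ i.1)) (κ (iterSup κ i'.1)) := le_max_right _ _
    -- Followed into a stage beyond both stable indices, `W.map f` becomes a stable image inclusion,
    -- which is in `M`.
    refine hEM.of_comp hp (g := m _ ≫ X.map (homOfLE h₂)) ?_
    have : W.map f ≫ m _ ≫ X.map (homOfLE h₂) = m _ ≫ X.map (homOfLE h₁) := by
      rw [← cancel_epi (e _), reassoc_of% hem]
      change e _ ≫ d _ _ (leOfHom f) ≫ _ = _
      rw [reassoc_of% hd, reassoc_of% hem, ← X.map_comp, ← X.map_comp, ← X.map_comp]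
      rfl
    rw [this]
    exact hm _ _ _
  let F := (Set.principalSegIio (iterSup κ α)).monotone.functor ⋙ X
  let ε : hb.functor ⋙ F ⟶ W :=
    { app i := e (iterSup κ i.1)
      naturality i i' f := (hd _ _ (leOfHom f)).symm }
  have (i : Set.Iio α) : Epi (ε.app i) := hepi _
  refine ⟨iterSup κ α, isSuccLimit_iterSup hκ hα, fun U hU ↦ ?_⟩
  have := hU W hW
  have : PreservesColimit (hb.functor ⋙ F) U := by
    refine preservesColimit_of_interleaving ε (fun i ↦ ?_) U
    have h := apply_iterSup_le κ (lt_add_one i.1)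
    refine ⟨⟨i.1 + 1, hα.add_one_lt i.2⟩, (lt_add_one i.1).le, m _ ≫ X.map (homOfLE h), ?_⟩
    change e _ ≫ m _ ≫ X.map (homOfLE h) = X.map _
    rw [reassoc_of% hem, ← X.map_comp]
    rfl
  exact preservesColimit_of_final hb.functor F U

end MChains

end SpecialChains

/-! ### The main theorem -/

theorem theorem4p5 {C : Type u} [Category.{v} C] [HasColimitsOfSize.{w, w} C]
    (T₁ T₂ : C ⥤ C) (η₁ : 𝟭 C ⟶ T₁) (η₂ : 𝟭 C ⟶ T₂)
    (γ : T₂ ⟶ T₁) (lam : T₂ ⟶ T₁ ⋙ T₁)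
    (hsize :
      (∃ α : Ordinal.{w}, Order.IsSuccLimit α ∧
        SpecialChains.PreservesChains α T₁ ∧ SpecialChains.PreservesChains α T₂) ∨
      (∃ E M : MorphismProperty C, SpecialChains.IsFactorisationSystem E M ∧
        SpecialChains.IsProper E M ∧ SpecialChains.IsCoWellPowered.{w} E ∧
        ∃ α : Ordinal.{w}, Order.IsSuccLimit α ∧
          SpecialChains.PreservesMChains α M T₁ ∧ SpecialChains.PreservesMChains α M T₂))
    (X : C) :
    (∃ (S : SpecialChains.SpecialChain.{w} η₁ γ lam) (i : X ≅ S.obj.X.obj 0),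
      SpecialChains.IsStarChain X S i) ∧
    ∀ (S : SpecialChains.SpecialChain.{w} η₁ γ lam) (i : X ≅ S.obj.X.obj 0),
      SpecialChains.IsStarChain X S i →
      SpecialChains.IsFreeOn (SpecialChains.SpecialChain.forget.{w} η₁ γ lam) X S i.hom ∧
      S.obj.Stabilises ∧
      ∀ (n : Ordinal.{w}) (hn : S.obj.StabilisesAt n),
        ∃ hs : SpecialChains.IsSpecialAlgebra η₁ γ lam (S.obj.pointAlgebra n hn),
          SpecialChains.IsFreeOn (SpecialChains.SpecialAlgebra.forget η₁ γ lam) X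
            ⟨S.obj.pointAlgebra n hn, hs⟩ (i.hom ≫ S.obj.j (zero_le (a := n))) := by
  refine ⟨SpecialChains.exists_isStarChain η₁ γ lam X, fun S i hS ↦
    ⟨hS.isFreeOn_forget, ?_, fun n hn ↦
      ⟨SpecialChains.IsStarChain.isSpecialAlgebra_pointAlgebra hn, hS.isFreeOn_pointAlgebra hn⟩⟩⟩
  obtain ⟨α, hα, h₁, h₂⟩ | ⟨E, M, hEM, hp, hE, α, hα, h₁, h₂⟩ := hsize
  · have := h₁ ((Set.principalSegIio α).monotone.functor ⋙ S.obj.X)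
    have := h₂ ((Set.principalSegIio α).monotone.functor ⋙ S.obj.X)
    exact ⟨α, hS.stabilisesAt_of_preservesColimit hα⟩
  · obtain ⟨β, hβ, hU⟩ := SpecialChains.exists_preservesColimit hEM hp hE hα S.obj.X
    have := hU T₁ h₁
    have := hU T₂ h₂
    exact ⟨β, hS.stabilisesAt_of_preservesColimit hβ⟩
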